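/- For $n\ge 0$ and $i\in\{1,\dots,n\}$ let $\mathfrak{A}_i$ be a unital C$^*$-algebra, let $\pi_i:\mathfrak{A}_i\to\mathcal{B}(\mathcal{H}_i)$ and $\pi'_i:\mathfrak{A}_i\to\mathcal{B}(\mathcal{H}'_i)$ be faithful unital $^*$-representations on complex Hilbert spaces, and let $\xi_i\in\mathcal{H}_i$ and $\xi'_i\in\mathcal{H}'_i$ be unit vectors such that $$\langle \pi_i(A)\xi_i,\xi_i\rangle_{\mathcal{H}_i}=\langle \pi'_i(A)\xi'_i,\xi'_i\rangle_{\mathcal{H}'_i}\qquad\text{for all } A\in\mathfrak{A}_i \text{ and all } i.$$ (The vectors are not assumed to be cyclic, and the GNS representations of these states are not assumed to be faithful.) Here the reduced free product $\ast_{i=1}^n(\mathfrak{A}_i,\pi_i,\xi_i)$ is defined as follows. Let $\mathcal{H}_i^0=\mathcal{H}_i\ominus\mathbb{C}\xi_i$, let $$\mathcal{H}=\mathbb{C}\xi_0\oplus\bigoplus_{m\ge1}\ \bigoplus_{i_1\ne i_2\ne\cdots\ne i_m}\mathcal{H}^0_{i_1}\otimes\cdots\otimes\mathcal{H}^0_{i_m}$$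 (Hilbert space sums and tensor products), let $\mathcal{H}(i)\subseteq\mathcal{H}$ be the sum of $\mathbb{C}\xi_0$ and the summands with $i_1\neq i$, and let $U_i:\mathcal{H}_i\otimes\mathcal{H}(i)\to\mathcal{H}$ be the unitary determined by $U_i(\xi_i\otimes\zeta)=\zeta$ for $\zeta\in\mathcal{H}(i)$, by $U_i(h\otimes\xi_0)=h$ for $h\in\mathcal{H}_i^0$, and by $U_i(h\otimes\zeta)=h\otimes\zeta$ for $h\in\mathcal{H}_i^0$ and $\zeta\in\mathcal{H}^0_{i_1}\otimes\cdots\otimes\mathcal{H}^0_{i_m}$ with $m\ge1$ and $i_1\ne i$. An element $A\in\mathfrak{A}_i$ acts on $\mathcal{H}$ as $U_i(\pi_i(A)\otimes\mathrm{Id})U_i^*$, and $\ast_{i=1}^n(\mathfrak{A}_i,\pi_i,\xi_i)$ is the unital C$^*$-subalgebra of $\mathcal{B}(\mathcal{H})$ generated by these operators for all $i$ and all $A\in\mathfrak{A}_i$. Then there exists a $^*$-isomorphism $$\Phi:\ast_{i=1}^n(\mathfrak{A}_i,\pi'_i,\xi'_i)\to\ast_{i=1}^n(\mathfrak{A}_i,\pi_i,\xi_i)$$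 such that, for every $i$ and every $A\in\mathfrak{A}_i$, $\Phi$ maps the copy of $A$ in the first algebra to the copy of $A$ in the second, i.e. $\Phi(A)=A$. -/

import Mathlib

open scoped TensorProduct InnerProductSpace

universe u v w

noncomputable section

namespace FreeProd

/-! ### Hilbert space tensor products -/

/-- The tensor product of two Hilbert spaces: the completion of the algebraic tensor product with
respect to the inner product `⟪x ⊗ y, x' ⊗ y'⟫ = ⟪x, x'⟫ * ⟪y, y'⟫`. -/
abbrev HilbertTensor (E : Type v) (F : Type w) [NormedAddCommGroup E] [InnerProductSpace ℂ E]
    [NormedAddCommGroup F] [InnerProductSpace ℂ F] : Type (max v w) :=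
  UniformSpace.Completion (E ⊗[ℂ] F)

section Tensor

variable {E : Type v} {F : Type w} [NormedAddCommGroup E] [InnerProductSpace ℂ E]
  [NormedAddCommGroup F] [InnerProductSpace ℂ F]

/-- The elementary tensor `x ⊗ y`, as a bounded bilinear map. -/
def tmul : E →L[ℂ] F →L[ℂ] HilbertTensor E F :=
  (ContinuousLinearMap.compL ℂ F (E ⊗[ℂ] F) (HilbertTensor E F)
    UniformSpace.Completion.toComplL).comp (TensorProduct.mkL ℂ E F)

theorem tmul_def (x : E) (y : F) : tmul x y = ((x ⊗ₜ[ℂ] y : E ⊗[ℂ] F) : HilbertTensor E F) := rfl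

theorem inner_tmul_tmul (x x' : E) (y y' : F) :
    inner ℂ (tmul x y) (tmul x' y') = inner ℂ x x' * inner ℂ y y' := by
  simp [tmul_def, UniformSpace.Completion.inner_coe]

theorem norm_tmul (x : E) (y : F) : ‖tmul x y‖ = ‖x‖ * ‖y‖ := by
  simp [tmul_def]

/-- Elementary tensors are total. -/
theorem hilbertTensor_induction {p : HilbertTensor E F → Prop} (hp : IsClosed {z | p z})
    (h0 : p 0) (hadd : ∀ a b, p a → p b → p (a + b)) (ht : ∀ x y, p (tmul x y)) (z) : p z := by
  refine UniformSpace.Completion.induction_on z hp fun a => ?_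
  induction a using TensorProduct.induction_on with
  | zero => exact h0
  | tmul x y => exact ht x y
  | add a b ha hb => rw [UniformSpace.Completion.coe_add]; exact hadd _ _ ha hb

section Lift

variable {G : Type*} [NormedAddCommGroup G] [InnerProductSpace ℂ G]

theorem inner_lift (β : E →ₗ[ℂ] F →ₗ[ℂ] G)
    (hβ : ∀ x x' y y', inner ℂ (β x y) (β x' y') = inner ℂ x x' * inner ℂ y y')
    (a b : E ⊗[ℂ] F) :
    inner ℂ (TensorProduct.lift β a) (TensorProduct.lift β b) = inner ℂ a b := by
  induction a using TensorProduct.induction_on with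
  | zero => simp
  | add a a' h h' => rw [map_add, inner_add_left, inner_add_left, h, h']
  | tmul x y =>
    induction b using TensorProduct.induction_on with
    | zero => simp
    | add a a' h h' => rw [map_add, inner_add_right, inner_add_right, h, h']
    | tmul x' y' => simp [hβ]

variable [CompleteSpace G]

/-- A bilinear map `β` with `⟪β x y, β x' y'⟫ = ⟪x, x'⟫ * ⟪y, y'⟫` induces an isometry
`x ⊗ y ↦ β x y` on the Hilbert space tensor product. -/
def liftIsometry (β : E →ₗ[ℂ] F →ₗ[ℂ] G)
    (hβ : ∀ x x' y y', inner ℂ (β x y) (β x' y') = inner ℂ x x' * inner ℂ y y') :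
    HilbertTensor E F →ₗᵢ[ℂ] G where
  toLinearMap := (((TensorProduct.lift β).isometryOfInner
    (inner_lift β hβ)).toContinuousLinearMap.extend
      (UniformSpace.Completion.toComplL : (E ⊗[ℂ] F) →L[ℂ] HilbertTensor E F)).toLinearMap
  norm_map' z := by
    refine UniformSpace.Completion.induction_on z (isClosed_eq ?_ continuous_norm) fun a => ?_
    · exact (ContinuousLinearMap.continuous _).norm
    · have h := ContinuousLinearMap.extend_eq (((TensorProduct.lift β).isometryOfInner
        (inner_lift β hβ)).toContinuousLinearMap)
        (e := (UniformSpace.Completion.toComplL : (E ⊗[ℂ] F) →L[ℂ] HilbertTensor E F))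
        UniformSpace.Completion.denseRange_coe
        (UniformSpace.Completion.isUniformInducing_coe _) a
      refine (congrArg norm h).trans ?_
      rw [UniformSpace.Completion.norm_coe]
      exact LinearIsometry.norm_map _ a

theorem liftIsometry_tmul (β : E →ₗ[ℂ] F →ₗ[ℂ] G)
    (hβ : ∀ x x' y y', inner ℂ (β x y) (β x' y') = inner ℂ x x' * inner ℂ y y') (x : E) (y : F) :
    liftIsometry β hβ (tmul x y) = β x y := by
  have h := ContinuousLinearMap.extend_eq (((TensorProduct.lift β).isometryOfInner
    (inner_lift β hβ)).toContinuousLinearMap)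
    (e := (UniformSpace.Completion.toComplL : (E ⊗[ℂ] F) →L[ℂ] HilbertTensor E F))
    UniformSpace.Completion.denseRange_coe
    (UniformSpace.Completion.isUniformInducing_coe _) (x ⊗ₜ y)
  exact h.trans (by simp)

end Lift

/-- The operator `T ⊗ Id` on the Hilbert space tensor product `E ⊗ F`. -/
def tensorId (F : Type w) [NormedAddCommGroup F] [InnerProductSpace ℂ F] (T : E →L[ℂ] E) :
    HilbertTensor E F →L[ℂ] HilbertTensor E F :=
  (T.rTensor F).completion

theorem tensorId_tmul (T : E →L[ℂ] E) (x : E) (y : F) :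
    tensorId F T (tmul x y) = tmul (T x) y := by
  simp [tensorId, tmul_def]

theorem tensorId_ext {S T : HilbertTensor E F →L[ℂ] HilbertTensor E F}
    (h : ∀ x y, S (tmul x y) = T (tmul x y)) : S = T := by
  ext z
  refine hilbertTensor_induction (p := fun z => S z = T z)
    (isClosed_eq S.continuous T.continuous) (by simp) ?_ h z
  intro a b ha hb
  simp only [map_add, ha, hb]

/-- `T ↦ T ⊗ Id` as a unital `*`-homomorphism. -/
def tensorIdHom (E : Type v) (F : Type w) [NormedAddCommGroup E] [InnerProductSpace ℂ E]
    [CompleteSpace E] [NormedAddCommGroup F] [InnerProductSpace ℂ F] :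
    (E →L[ℂ] E) →⋆ₐ[ℂ] (HilbertTensor E F →L[ℂ] HilbertTensor E F) where
  toFun T := tensorId F T
  map_one' := tensorId_ext fun x y => by simp [tensorId_tmul]
  map_mul' S T := tensorId_ext fun x y => by simp [tensorId_tmul]
  map_zero' := tensorId_ext fun x y => by simp [tensorId_tmul]
  map_add' S T := tensorId_ext fun x y => by simp [tensorId_tmul]
  commutes' c := tensorId_ext fun x y => by simp [tensorId_tmul, Algebra.algebraMap_eq_smul_one]
  map_star' T := by
    rw [ContinuousLinearMap.star_eq_adjoint, ContinuousLinearMap.star_eq_adjoint,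
      ContinuousLinearMap.eq_adjoint_iff]
    intro a b
    refine hilbertTensor_induction
      (p := fun a => inner ℂ (tensorId F (ContinuousLinearMap.adjoint T) a) b
        = inner ℂ a (tensorId F T b)) (isClosed_eq (by fun_prop) (by fun_prop)) (by simp)
      (fun a a' h h' => by simp only [map_add, inner_add_left, h, h']) (fun x y => ?_) a
    refine hilbertTensor_induction
      (p := fun b => inner ℂ (tensorId F (ContinuousLinearMap.adjoint T) (tmul x y)) b
        = inner ℂ (tmul x y) (tensorId F T b)) (isClosed_eq (by fun_prop) (by fun_prop)) (by simp)
      (fun a a' h h' => by simp only [map_add, inner_add_right, h, h']) (fun x' y' => ?_) b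
    simp only [tensorId_tmul, inner_tmul_tmul, ContinuousLinearMap.adjoint_inner_left]

end Tensor

/-! ### Hilbert space direct sums -/

section Sum

variable {α : Type*} {β : Type*} {γ : Type*} (G : β → Type v) [∀ b, NormedAddCommGroup (G b)]
  [∀ b, InnerProductSpace ℂ (G b)]

open scoped Classical in
/-- The inclusion of a summand in a Hilbert space direct sum. -/
def single (b : β) : G b →ₗᵢ[ℂ] lp G 2 where
  toLinearMap := lp.lsingle (𝕜 := ℂ) 2 b
  norm_map' x := lp.norm_single (by norm_num) b x

theorem single_apply_self (b : β) (x : G b) : single G b x b = x := by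
  classical
  refine Eq.trans ?_ (lp.single_apply_self 2 b x)
  convert! rfl

theorem single_apply_ne {b c : β} (h : b ≠ c) (y : G c) : single G c y b = 0 := by
  classical
  refine Eq.trans ?_ (lp.single_apply_ne 2 c y h)
  convert! rfl

theorem inner_single_self (b : β) (x y : G b) :
    inner ℂ (single G b x) (single G b y) = inner ℂ x y :=
  (single G b).inner_map_map x y

theorem inner_single_ne {b c : β} (h : b ≠ c) (x : G b) (y : G c) :
    inner ℂ (single G b x) (single G c y) = 0 := by
  classical
  have := lp.inner_single_left (𝕜 := ℂ) b x (single G c y)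
  rw [single_apply_ne G h, inner_zero_right] at this
  exact Eq.trans (by convert! rfl) this

theorem hasSum_single (f : lp G 2) : HasSum (fun b => single G b (f b)) f := by
  classical
  convert! lp.hasSum_single (E := G) (p := 2) (by norm_num) f

variable {G' : α → Type v} [∀ a, NormedAddCommGroup (G' a)]
  [∀ a, InnerProductSpace ℂ (G' a)] {G'' : γ → Type v} [∀ a, NormedAddCommGroup (G'' a)]
  [∀ a, InnerProductSpace ℂ (G'' a)]

theorem orthogonalFamily_single {f : α → β} (hf : Function.Injective f)
    (V : ∀ a, G' a →ₗᵢ[ℂ] G (f a)) :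
    OrthogonalFamily ℂ G' (fun a => (single G (f a)).comp (V a)) :=
  fun _ _ h x y => inner_single_ne G (hf.ne h) (V _ x) (V _ y)

variable [∀ b, CompleteSpace (G b)]

/-- The isometry `⨁ a, G' a → ⨁ b, G b` which maps the summand `G' a` to the summand `G (f a)` by
`V a`, for an injective map `f` of the index sets. -/
def sumMap {f : α → β} (hf : Function.Injective f) (V : ∀ a, G' a →ₗᵢ[ℂ] G (f a)) :
    lp G' 2 →ₗᵢ[ℂ] lp G 2 :=
  (orthogonalFamily_single G hf V).linearIsometry

theorem sumMap_single {f : α → β} (hf : Function.Injective f) (V : ∀ a, G' a →ₗᵢ[ℂ] G (f a))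
    (a : α) (x : G' a) : sumMap G hf V (single G' a x) = single G (f a) (V a x) := by
  classical
  refine Eq.trans ?_ ((orthogonalFamily_single G hf V).linearIsometry_apply_single x)
  unfold sumMap
  congr 1

theorem inner_sumMap_eq_zero {f : α → β} {g : γ → β} (hf : Function.Injective f)
    (hg : Function.Injective g) (hfg : ∀ a c, f a ≠ g c) (V : ∀ a, G' a →ₗᵢ[ℂ] G (f a))
    (W : ∀ c, G'' c →ₗᵢ[ℂ] G (g c)) (x : lp G' 2) (y : lp G'' 2) :
    inner ℂ (sumMap G hf V x) (sumMap G hg W y) = 0 := by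
  have hx := (orthogonalFamily_single G hf V).hasSum_linearIsometry x
  have hy := (orthogonalFamily_single G hg W).hasSum_linearIsometry y
  have h1 : ∀ c (v : G (g c)), inner ℂ (single G (g c) v) (sumMap G hf V x) = 0 := fun c v =>
    (hx.mapL (innerSL ℂ (single G (g c) v))).unique (by
      convert! hasSum_zero with a
      exact inner_single_ne G (hfg a c).symm _ _)
  refine (hy.mapL (innerSL ℂ (sumMap G hf V x))).unique ?_
  convert! hasSum_zero with c
  exact inner_eq_zero_symm.1 (h1 c _)

end Sum

/-! ### The free product of Hilbert spaces with distinguished unit vectors -/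

/-- A bundled complex Hilbert space. -/
structure HilbertSpace : Type (v + 1) where
  carrier : Type v
  [normed : NormedAddCommGroup carrier]
  [innerProd : InnerProductSpace ℂ carrier]
  [complete : CompleteSpace carrier]

instance : CoeSort HilbertSpace.{v} (Type v) := ⟨HilbertSpace.carrier⟩

attribute [instance] HilbertSpace.normed HilbertSpace.innerProd HilbertSpace.complete

section Words

variable {ι : Type u}

/-- `E i₁ ⊗ (E i₂ ⊗ (⋯ ⊗ (E iₙ ⊗ ℂ)))` for the word `[i₁, …, iₙ]`. The one-dimensional space `ℂ`,
attached to the empty word, is written as `EuclideanSpace ℂ PUnit` for universe reasons. -/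
def tensorWord (E : ι → Type v) [∀ i, NormedAddCommGroup (E i)] [∀ i, InnerProductSpace ℂ (E i)] :
    List ι → HilbertSpace.{v}
  | [] => ⟨EuclideanSpace ℂ PUnit.{v + 1}⟩
  | i :: w => ⟨HilbertTensor (E i) (tensorWord E w)⟩

variable (ι) in
/-- Words `i₁ i₂ ⋯ iₙ`, `n ≥ 0`, with `iₖ ≠ iₖ₊₁` for all `k`. -/
abbrev Word : Type u := {w : List ι // w.IsChain (· ≠ ·)}

/-- Alternating words `i₁ i₂ ⋯ iₙ`, `n ≥ 0`, that do not start with the letter `i`. -/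
abbrev WordNot (i : ι) : Type u := {w : Word ι // w.1.head? ≠ some i}

/-- The word `i i₁ i₂ ⋯ iₙ`. -/
def WordNot.cons {i : ι} (w : WordNot i) : Word ι :=
  ⟨i :: w.1.1, List.isChain_cons.2 ⟨fun _ hj h => w.2 (h ▸ hj), w.1.2⟩⟩

theorem WordNot.cons_injective {i : ι} : Function.Injective (WordNot.cons (i := i)) := by
  intro w w' h
  exact Subtype.ext (Subtype.ext (List.cons_injective (congrArg Subtype.val h)))

theorem exists_cons_eq {i : ι} (w : Word ι) (hw : w.1.head? = some i) :
    ∃ w' : WordNot i, w'.cons = w := by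
  obtain ⟨_ | ⟨j, l⟩, hl⟩ := w
  · simp at hw
  · obtain rfl : j = i := by simpa using hw
    obtain ⟨h1, h2⟩ := List.isChain_cons.1 hl
    exact ⟨⟨⟨l, h2⟩, fun h => h1 _ h rfl⟩, rfl⟩

variable (H : ι → Type v) [∀ i, NormedAddCommGroup (H i)] [∀ i, InnerProductSpace ℂ (H i)]
  (ξ : ∀ i, H i)

/-- `H i ⊖ ℂ ξ i`. -/
abbrev Centered (i : ι) : Type v := ((ℂ ∙ ξ i)ᗮ : Submodule ℂ (H i))

/-- The summand `H⁰ i₁ ⊗ ⋯ ⊗ H⁰ iₙ` of the free product attached to the word `i₁ ⋯ iₙ`, where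
`H⁰ i = H i ⊖ ℂ ξ i`. -/
abbrev Summand (w : Word ι) : Type v := tensorWord (Centered H ξ) w.1

/-- The free product of the Hilbert spaces `H i` with respect to the unit vectors `ξ i`: the
Hilbert space direct sum of `H⁰ i₁ ⊗ ⋯ ⊗ H⁰ iₙ` over all `n ≥ 0` and all words `i₁ ⋯ iₙ` with
`iₖ ≠ iₖ₊₁`. -/
abbrev FreeProduct : Type (max u v) := lp (Summand H ξ) 2

/-- The subspace `H(i)` of the free product given by the words that do not start with `i`. -/
abbrev FreeProductNot (i : ι) : Type (max u v) :=
  lp (fun w : WordNot i => Summand H ξ w.1) 2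

/-- The direct sum of `H⁰ i ⊗ H⁰ i₁ ⊗ ⋯ ⊗ H⁰ iₙ` over the words `i₁ ⋯ iₙ` not starting with
`i`. -/
abbrev FreeProductCons (i : ι) : Type (max u v) :=
  lp (fun w : WordNot i => HilbertTensor (Centered H ξ i) (Summand H ξ w.1)) 2

theorem memℓp_tmul (i : ι) (h : Centered H ξ i) (ζ : FreeProductNot H ξ i) :
    Memℓp (fun w : WordNot i => tmul h (ζ w)) 2 := by
  have h2 : 0 < (2 : ENNReal).toReal := by norm_num
  rw [memℓp_gen_iff h2]
  simp only [norm_tmul]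
  simp only [Real.mul_rpow (norm_nonneg _) (norm_nonneg _)]
  exact ((memℓp_gen_iff h2).1 (lp.memℓp ζ)).mul_left _

/-- The vector `h ⊗ ζ` for `h ∈ H⁰ i` and `ζ ∈ H(i)`, with the components `h ⊗ ζ w`. -/
def tensorLeft (i : ι) (h : Centered H ξ i) (ζ : FreeProductNot H ξ i) : FreeProductCons H ξ i :=
  ⟨fun w => tmul h (ζ w), memℓp_tmul H ξ i h ζ⟩

theorem tensorLeft_apply (i : ι) (h : Centered H ξ i) (ζ : FreeProductNot H ξ i) (w : WordNot i) :
    tensorLeft H ξ i h ζ w = tmul h (ζ w) := rfl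

theorem tensorLeft_add_left (i : ι) (h h' : Centered H ξ i) (ζ : FreeProductNot H ξ i) :
    tensorLeft H ξ i (h + h') ζ = tensorLeft H ξ i h ζ + tensorLeft H ξ i h' ζ := by
  ext1; funext w
  simp [tensorLeft_apply]

theorem tensorLeft_smul_left (i : ι) (c : ℂ) (h : Centered H ξ i) (ζ : FreeProductNot H ξ i) :
    tensorLeft H ξ i (c • h) ζ = c • tensorLeft H ξ i h ζ := by
  ext1; funext w
  simp [tensorLeft_apply]

theorem tensorLeft_zero_left (i : ι) (ζ : FreeProductNot H ξ i) : tensorLeft H ξ i 0 ζ = 0 := by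
  ext1; funext w
  simp [tensorLeft_apply]

theorem tensorLeft_add_right (i : ι) (h : Centered H ξ i) (ζ ζ' : FreeProductNot H ξ i) :
    tensorLeft H ξ i h (ζ + ζ') = tensorLeft H ξ i h ζ + tensorLeft H ξ i h ζ' := by
  ext1; funext w
  simp [tensorLeft_apply]

theorem tensorLeft_smul_right (i : ι) (c : ℂ) (h : Centered H ξ i) (ζ : FreeProductNot H ξ i) :
    tensorLeft H ξ i h (c • ζ) = c • tensorLeft H ξ i h ζ := by
  ext1; funext w
  simp [tensorLeft_apply]

theorem inner_tensorLeft (i : ι) (h h' : Centered H ξ i) (ζ ζ' : FreeProductNot H ξ i) :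
    inner ℂ (tensorLeft H ξ i h ζ) (tensorLeft H ξ i h' ζ') = inner ℂ h h' * inner ℂ ζ ζ' := by
  rw [lp.inner_eq_tsum, lp.inner_eq_tsum, ← tsum_mul_left]
  exact tsum_congr fun w => inner_tmul_tmul _ _ _ _

theorem tensorLeft_single (i : ι) (h : Centered H ξ i) (w : WordNot i) (z : Summand H ξ w.1) :
    tensorLeft H ξ i h (single (fun w : WordNot i => Summand H ξ w.1) w z) =
      single (fun w : WordNot i => HilbertTensor (Centered H ξ i) (Summand H ξ w.1)) w
        (tmul h z) := by
  ext1; funext w'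
  rw [tensorLeft_apply]
  by_cases hw : w' = w
  · subst hw
    rw [single_apply_self, single_apply_self]
  · rw [single_apply_ne _ hw, single_apply_ne _ hw, map_zero]

/-- The inclusion of `H(i)` in the free product. -/
def inclNot (i : ι) : FreeProductNot H ξ i →ₗᵢ[ℂ] FreeProduct H ξ :=
  sumMap (Summand H ξ) (f := fun w : WordNot i => w.1) Subtype.val_injective
    (fun _ => LinearIsometry.id)

/-- By definition, `H⁰ i ⊗ (H⁰ i₁ ⊗ ⋯ ⊗ H⁰ iₙ)` is the summand of the word `i i₁ ⋯ iₙ`. -/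
def consIso {i : ι} (w : WordNot i) :
    HilbertTensor (Centered H ξ i) (Summand H ξ w.1) ≃ₗᵢ[ℂ] Summand H ξ w.cons :=
  LinearIsometryEquiv.refl ℂ (HilbertTensor (Centered H ξ i) (Summand H ξ w.1))

/-- The inclusion in the free product of the sum of the `H⁰ i ⊗ H⁰ i₁ ⊗ ⋯ ⊗ H⁰ iₙ` over the words
`i₁ ⋯ iₙ` that do not start with `i`. -/
def inclCons (i : ι) : FreeProductCons H ξ i →ₗᵢ[ℂ] FreeProduct H ξ :=
  sumMap (Summand H ξ) WordNot.cons_injective (fun w => (consIso H ξ w).toLinearIsometry)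

theorem inner_inclNot_inclCons (i : ι) (ζ : FreeProductNot H ξ i) (η : FreeProductCons H ξ i) :
    inner ℂ (inclNot H ξ i ζ) (inclCons H ξ i η) = 0 := by
  refine inner_sumMap_eq_zero _ _ _ (fun w w' h => w.2 ?_) _ _ _ _
  rw [h]
  rfl

/-- The bilinear map `H i × H(i) → H` underlying the canonical isomorphism `H i ⊗ H(i) ≅ H`:
it sends `(ξ i, ζ)` to `ζ`, and `(h, ζ)` to `h ⊗ ζ` for `h` orthogonal to `ξ i`. -/
def canonicalBilin (i : ι) : H i →ₗ[ℂ] FreeProductNot H ξ i →ₗ[ℂ] FreeProduct H ξ :=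
  LinearMap.mk₂ ℂ
    (fun h ζ => inner ℂ (ξ i) h • inclNot H ξ i ζ +
      inclCons H ξ i (tensorLeft H ξ i ((ℂ ∙ ξ i)ᗮ.orthogonalProjectionOnto h) ζ))
    (fun h h' ζ => by
      rw [map_add, tensorLeft_add_left, map_add, inner_add_right, add_smul]; abel)
    (fun c h ζ => by
      rw [map_smul, tensorLeft_smul_left, map_smul, inner_smul_right, smul_add, smul_smul])
    (fun h ζ ζ' => by
      rw [map_add, tensorLeft_add_right, map_add, smul_add]; abel)
    (fun c h ζ => by
      rw [map_smul, tensorLeft_smul_right, map_smul, smul_add, smul_comm])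

theorem canonicalBilin_apply (i : ι) (h : H i) (ζ : FreeProductNot H ξ i) :
    canonicalBilin H ξ i h ζ = inner ℂ (ξ i) h • inclNot H ξ i ζ +
      inclCons H ξ i (tensorLeft H ξ i ((ℂ ∙ ξ i)ᗮ.orthogonalProjectionOnto h) ζ) := rfl


theorem inner_eq_add_centered {E : Type*} [NormedAddCommGroup E] [InnerProductSpace ℂ E] {e : E}
    (he : ‖e‖ = 1) (h h' : E) :
    inner ℂ h h' = inner ℂ h e * inner ℂ e h' +
      inner ℂ ((ℂ ∙ e)ᗮ.orthogonalProjectionOnto h) ((ℂ ∙ e)ᗮ.orthogonalProjectionOnto h') := by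
  have key : ∀ x : E, ((ℂ ∙ e)ᗮ.orthogonalProjectionOnto x : E) = x - inner ℂ e x • e := by
    intro x
    rw [← Submodule.starProjection_apply, Submodule.starProjection_orthogonal_val,
      Submodule.starProjection_unit_singleton ℂ he]
  rw [Submodule.coe_inner, key, key]
  simp only [inner_sub_left, inner_sub_right, inner_smul_left, inner_smul_right, inner_conj_symm,
    inner_self_eq_norm_sq_to_K, he]
  simp

theorem inner_canonicalBilin (hξ : ∀ i, ‖ξ i‖ = 1) (i : ι) (h h' : H i)
    (ζ ζ' : FreeProductNot H ξ i) :
    inner ℂ (canonicalBilin H ξ i h ζ) (canonicalBilin H ξ i h' ζ') =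
      inner ℂ h h' * inner ℂ ζ ζ' := by
  have e := inner_eq_add_centered (hξ i) h h'
  rw [canonicalBilin_apply, canonicalBilin_apply, inner_add_left, inner_add_right, inner_add_right,
    inner_smul_left, inner_smul_right, inner_smul_left, inner_inclNot_inclCons, inner_smul_right,
    inner_eq_zero_symm.1 (inner_inclNot_inclCons H ξ i _ _), LinearIsometry.inner_map_map,
    LinearIsometry.inner_map_map, inner_tensorLeft, e, inner_conj_symm]
  ring

/-- The canonical isometry `H i ⊗ H(i) → H`. -/
def canonicalIsometry (hξ : ∀ i, ‖ξ i‖ = 1) (i : ι) :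
    HilbertTensor (H i) (FreeProductNot H ξ i) →ₗᵢ[ℂ] FreeProduct H ξ :=
  liftIsometry (canonicalBilin H ξ i) (inner_canonicalBilin H ξ hξ i)

theorem canonicalIsometry_distinguished (hξ : ∀ i, ‖ξ i‖ = 1) {i : ι} (w : WordNot i)
    (z : Summand H ξ w.1) :
    canonicalIsometry H ξ hξ i (tmul (ξ i) (single (fun w : WordNot i => Summand H ξ w.1) w z)) =
      single (Summand H ξ) w.1 z := by
  rw [canonicalIsometry, liftIsometry_tmul, canonicalBilin_apply, inner_self_eq_norm_sq_to_K, hξ i,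
    (Submodule.orthogonalProjectionOnto_eq_zero_iff (K := (ℂ ∙ ξ i)ᗮ)).2
      (Submodule.le_orthogonal_orthogonal _ (Submodule.mem_span_singleton_self _)),
    tensorLeft_zero_left, inclNot, sumMap_single]
  simp

theorem canonicalIsometry_centered (hξ : ∀ i, ‖ξ i‖ = 1) {i : ι} (h : Centered H ξ i)
    (w : WordNot i) (z : Summand H ξ w.1) :
    canonicalIsometry H ξ hξ i
      (tmul (h : H i) (single (fun w : WordNot i => Summand H ξ w.1) w z)) =
      single (Summand H ξ) w.cons (consIso H ξ w (tmul h z)) := by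
  rw [canonicalIsometry, liftIsometry_tmul, canonicalBilin_apply,
    Submodule.mem_orthogonal_singleton_iff_inner_right.1 h.2,
    Submodule.orthogonalProjectionOnto_mem_subspace_eq_self, tensorLeft_single, inclCons,
    sumMap_single]
  simp

theorem canonicalIsometry_surjective (hξ : ∀ i, ‖ξ i‖ = 1) (i : ι) :
    Function.Surjective (canonicalIsometry H ξ hξ i) := by
  set U := canonicalIsometry H ξ hξ i with hU
  have hcl : IsClosed (Set.range U) := U.isometry.isClosedEmbedding.isClosed_range
  let R : Submodule ℂ (FreeProduct H ξ) := LinearMap.range U.toLinearMap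
  have hR : IsClosed (R : Set (FreeProduct H ξ)) := hcl
  have hs : ∀ (w : Word ι) (z : Summand H ξ w), single (Summand H ξ) w z ∈ R := by
    intro w z
    by_cases hw : w.1.head? = some i
    · obtain ⟨w', rfl⟩ := exists_cons_eq w hw
      obtain ⟨y, rfl⟩ := (consIso H ξ w').surjective z
      refine hilbertTensor_induction
        (p := fun y => single (Summand H ξ) w'.cons (consIso H ξ w' y) ∈ R)
        (hR.preimage ((LinearIsometry.continuous _).comp (LinearIsometryEquiv.continuous _)))
        (by simp) (fun a b ha hb => by simpa only [map_add] using R.add_mem ha hb)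
        (fun h ζ => ?_) y
      refine ⟨tmul (h : H i) (single (fun w : WordNot i => Summand H ξ w.1) w' ζ), ?_⟩
      exact canonicalIsometry_centered H ξ hξ h w' ζ
    · exact ⟨tmul (ξ i) (single (fun w : WordNot i => Summand H ξ w.1) ⟨w, hw⟩ z),
        canonicalIsometry_distinguished H ξ hξ ⟨w, hw⟩ z⟩
  intro f
  have : f ∈ R := hR.mem_of_tendsto (hasSum_single (Summand H ξ) f)
    (Filter.Eventually.of_forall fun s => R.sum_mem fun w _ => hs w _)
  exact this

/-- The canonical isomorphism `H i ⊗ H(i) ≅ H`: for `ζ` in `H⁰ i₁ ⊗ ⋯ ⊗ H⁰ iₙ` with `i₁ ≠ i`,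
it sends `ξ i ⊗ ζ` to `ζ`, and `h ⊗ ζ` with `h ∈ H⁰ i` to the vector `h ⊗ ζ` of
`H⁰ i ⊗ H⁰ i₁ ⊗ ⋯ ⊗ H⁰ iₙ`. -/
def canonicalIso (hξ : ∀ i, ‖ξ i‖ = 1) (i : ι) :
    HilbertTensor (H i) (FreeProductNot H ξ i) ≃ₗᵢ[ℂ] FreeProduct H ξ :=
  LinearIsometryEquiv.ofSurjective (canonicalIsometry H ξ hξ i)
    (canonicalIsometry_surjective H ξ hξ i)

variable [∀ i, CompleteSpace (H i)]

/-- The action `T ↦ U (T ⊗ Id) U*` of `B(H i)` on the free product, where `U` is the canonical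
isomorphism `H i ⊗ H(i) ≅ H`. -/
def freeAction (hξ : ∀ i, ‖ξ i‖ = 1) (i : ι) :
    (H i →L[ℂ] H i) →⋆ₐ[ℂ] (FreeProduct H ξ →L[ℂ] FreeProduct H ξ) :=
  (StarAlgEquiv.toStarAlgHom (canonicalIso H ξ hξ i).conjStarAlgEquiv).comp
    (tensorIdHom (H i) (FreeProductNot H ξ i))

variable {H} {A : ι → Type w} [∀ i, CStarAlgebra (A i)] (π : ∀ i, A i →⋆ₐ[ℂ] (H i →L[ℂ] H i))
  {ξ} (hξ : ∀ i, ‖ξ i‖ = 1)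

/-- The reduced free product `∗ᵢ (A i, π i, ξ i)`: the C⋆-subalgebra of the bounded operators on
the free product of the Hilbert spaces `(H i, ξ i)` generated by the images of the `A i`. -/
def ReducedFreeProduct :
    StarSubalgebra ℂ (FreeProduct H ξ →L[ℂ] FreeProduct H ξ) :=
  (StarAlgebra.adjoin ℂ
    (⋃ i, Set.range fun a : A i => freeAction H ξ hξ i (π i a))).topologicalClosure

/-- The canonical `*`-homomorphism from `A i` to the reduced free product. -/
def inclusion (i : ι) : A i →⋆ₐ[ℂ] ReducedFreeProduct π hξ :=
  ((freeAction H ξ hξ i).comp (π i)).codRestrict _ fun a =>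
    StarSubalgebra.le_topologicalClosure _
      (StarAlgebra.subset_adjoin ℂ _ (Set.mem_iUnion.2 ⟨i, a, rfl⟩))

end Words

end FreeProd

end

/-! Let `P` be the `*`-algebra generated by the pairs (copy of `a` on `H`, copy of `a` on `H'`). If
the two components of every element of `P` have equal norm, the closure of `P` is the graph of the
required isomorphism. By symmetry, `‖x.2‖ ≤ ‖x.1‖` suffices.

Call a vector `v` of the second free product dominated if `‖x.2 v‖ ≤ C ‖x.1‖` for all `x ∈ P`, with
`C` depending on `v`. If such vectors are dense, the inequality follows: for `T = x.2* x.2`, the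
powers of `T` grow on a dominated vector at most like those of `‖x.1‖²`, and log-convexity of `k ↦
‖T ^ k v‖` removes the constant (`norm_snd_le_norm_fst`).

Equality of the states enters through reduced words, which are the same on both sides and span `P`.
Compressing `x.1` to `H i ⊗ Ω`, with `Ω` the vacuum, gives an element `a` of `A i`, the conditional
expectation of `x`; as `π i` is faithful, `‖a‖ ≤ ‖x.1‖`. Compressing `x.2` to `H' i ⊗ Ω` gives the
same `a`, and so does compressing it to `M ⊗ ζ`, where `M` is the orthogonal complement of the
cyclic subspace of `ξ' i` and `ζ` lies in the summand of a word not starting with `i`. Vectors of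
these subspaces are therefore dominated (`canonicalBilin_mem_dominatedVectors`).

Density follows by induction on words: for `h` in the cyclic subspace, `h ⊗ ζ` is a limit of vectors
`a ζ`, and the closure of the dominated vectors is invariant under `P`; for `h ∈ M`, `h ⊗ ζ` is
dominated directly. -/

noncomputable section

namespace FreeProd

/-! ### `*`-homomorphisms that are isometric on generated subalgebras -/

section Graph

variable {C B : Type*} [NormedRing C] [NormedAlgebra ℂ C] [StarRing C] [StarModule ℂ C]
  [ContinuousStar C] [CompleteSpace C] [NormedRing B] [NormedAlgebra ℂ B] [StarRing B]
  [StarModule ℂ B] [ContinuousStar B]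

/-- A continuous `*`-homomorphism which is isometric on the `*`-algebra generated by `s` restricts
to a `*`-isomorphism between the closures of the `*`-algebras generated by `s` and its image. -/
theorem exists_starAlgEquiv_of_norm_eq (p : C →⋆ₐ[ℂ] B) (hp : Continuous p) (s : Set C) (t : Set B)
    (hst : p '' s = t) (h : ∀ x ∈ StarAlgebra.adjoin ℂ s, ‖p x‖ = ‖x‖) :
    ∃ e : (StarAlgebra.adjoin ℂ s).topologicalClosure ≃⋆ₐ[ℂ]
        (StarAlgebra.adjoin ℂ t).topologicalClosure,
      ∀ x, (e x : B) = p x := by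
  subst hst
  set P := (StarAlgebra.adjoin ℂ s).topologicalClosure with hP
  set R := (StarAlgebra.adjoin ℂ (p '' s)).topologicalClosure with hR
  have hPc : IsClosed (P : Set C) := StarSubalgebra.isClosed_topologicalClosure _
  have hRc : IsClosed (R : Set B) := StarSubalgebra.isClosed_topologicalClosure _
  have hnorm : ∀ x ∈ P, ‖p x‖ = ‖x‖ := by
    intro x hx
    have : closure (StarAlgebra.adjoin ℂ s : Set C) ⊆ {x | ‖p x‖ = ‖x‖} :=
      closure_minimal h (isClosed_eq hp.norm continuous_norm)
    exact this hx
  have hmem : ∀ x : P, p x ∈ R := by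
    have : P ≤ R.comap p := by
      refine StarSubalgebra.topologicalClosure_minimal (StarAlgebra.adjoin_le fun x hx => ?_)
        (hRc.preimage hp)
      exact StarSubalgebra.le_topologicalClosure _
        (StarAlgebra.subset_adjoin ℂ _ (Set.mem_image_of_mem p hx))
    exact fun x => this x.2
  let q : P →⋆ₐ[ℂ] B := p.comp P.subtype
  have hq : Isometry q := AddMonoidHomClass.isometry_of_norm q fun x => hnorm x x.2
  have : CompleteSpace P := hPc.completeSpace_coe
  -- An isometric image of a complete space is closed, so it contains all of `R`; this gives
  -- surjectivity.
  have hqc : IsClosed (q.range : Set B) := by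
    have := hq.isClosedEmbedding.isClosed_range
    convert this using 1
    ext x
    exact ⟨fun ⟨a, ha⟩ => ⟨a, ha⟩, fun ⟨a, ha⟩ => ⟨a, ha⟩⟩
  have hle : R ≤ q.range := by
    refine StarSubalgebra.topologicalClosure_minimal (StarAlgebra.adjoin_le ?_) hqc
    rintro _ ⟨x, hx, rfl⟩
    exact ⟨⟨x, StarSubalgebra.le_topologicalClosure _ (StarAlgebra.subset_adjoin ℂ _ hx)⟩, rfl⟩
  refine ⟨StarAlgEquiv.ofBijective (q.codRestrict R hmem) ⟨?_, ?_⟩, fun x => rfl⟩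
  · intro x y hxy
    exact hq.injective (congrArg Subtype.val hxy)
  · rintro ⟨y, hy⟩
    obtain ⟨x, hx⟩ := hle hy
    exact ⟨x, Subtype.ext hx⟩

/-- Two families of `*`-homomorphisms generate isomorphic closed algebras if the two components of
every element of the algebra generated by the pairs have the same norm. -/
theorem exists_starAlgEquiv_of_norm_fst_eq_norm_snd {ι : Type*} {A : ι → Type*}
    [CompleteSpace B] (j : ∀ i, A i → B) (j' : ∀ i, A i → C)
    (h : ∀ x ∈ StarAlgebra.adjoin ℂ (⋃ i, Set.range fun a : A i => (j i a, j' i a)),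
      ‖x.1‖ = ‖x.2‖) :
    ∃ Φ : (StarAlgebra.adjoin ℂ (⋃ i, Set.range fun a : A i => j' i a)).topologicalClosure ≃⋆ₐ[ℂ]
        (StarAlgebra.adjoin ℂ (⋃ i, Set.range fun a : A i => j i a)).topologicalClosure,
      ∀ i (a : A i) x y, x.1 = j' i a → y.1 = j i a → Φ x = y := by
  set s := ⋃ i, Set.range fun a : A i => (j i a, j' i a) with hs
  -- The product carries the maximum norm, so equal component norms make both projections isometric.
  obtain ⟨e, he⟩ := exists_starAlgEquiv_of_norm_eq (StarAlgHom.fst ℂ B C) continuous_fst s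
    (⋃ i, Set.range fun a : A i => j i a)
    (by rw [hs, Set.image_iUnion]; simp only [← Set.range_comp]; rfl)
    (fun x hx => by rw [Prod.norm_def, ← h x hx, max_self]; rfl)
  obtain ⟨e', he'⟩ := exists_starAlgEquiv_of_norm_eq (StarAlgHom.snd ℂ B C) continuous_snd s
    (⋃ i, Set.range fun a : A i => j' i a)
    (by rw [hs, Set.image_iUnion]; simp only [← Set.range_comp]; rfl)
    (fun x hx => by rw [Prod.norm_def, h x hx, max_self]; rfl)
  refine ⟨e'.symm.trans e, fun i a x y hx hy => ?_⟩
  have hz : (j i a, j' i a) ∈ (StarAlgebra.adjoin ℂ s).topologicalClosure :=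
    StarSubalgebra.le_topologicalClosure _
      (StarAlgebra.subset_adjoin ℂ _ (Set.mem_iUnion.2 ⟨i, a, rfl⟩))
  have h1 : e' ⟨_, hz⟩ = x := Subtype.ext ((he' ⟨_, hz⟩).trans hx.symm)
  have h2 : e ⟨_, hz⟩ = y := Subtype.ext ((he ⟨_, hz⟩).trans hy.symm)
  rw [← h1, ← h2]
  exact congrArg e (e'.symm_apply_apply ⟨_, hz⟩)

end Graph

/-! ### Bounding an operator on a dense subspace of growth vectors -/

section Growth

variable {E : Type*} [NormedAddCommGroup E] [InnerProductSpace ℂ E] [CompleteSpace E]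

/-- Cauchy–Schwarz for `‖T x‖² = ⟪T² x, x⟫`. Applied to `T ^ k x`, it is the log-convexity of `k ↦
‖T ^ k x‖`. -/
theorem norm_apply_sq_le_of_isSelfAdjoint {T : E →L[ℂ] E} (hT : IsSelfAdjoint T) (x : E) :
    ‖T x‖ ^ 2 ≤ ‖T (T x)‖ * ‖x‖ := by
  have h : (inner ℂ (T x) (T x) : ℂ) = inner ℂ (T (T x)) x := by
    rw [← ContinuousLinearMap.adjoint_inner_right, ← ContinuousLinearMap.star_eq_adjoint,
      hT.star_eq, ← ContinuousLinearMap.adjoint_inner_left, ← ContinuousLinearMap.star_eq_adjoint,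
      hT.star_eq]
    rw [← ContinuousLinearMap.adjoint_inner_left, ← ContinuousLinearMap.star_eq_adjoint,
      hT.star_eq]
  rw [inner_self_eq_norm_sq_to_K] at h
  have h' := norm_inner_le_norm (𝕜 := ℂ) (T (T x)) x
  rw [← h] at h'
  simpa using h'

/-- If the powers of a self-adjoint operator grow on a vector `x` at most as the powers of `M`,
then the operator scales `x` at most by `M`. -/
theorem norm_apply_le_of_pow_growth {T : E →L[ℂ] E} (hT : IsSelfAdjoint T) {M C : ℝ} (hM : 0 ≤ M)
    {x : E} (h : ∀ k : ℕ, ‖(T ^ k) x‖ ≤ C * M ^ k) : ‖T x‖ ≤ M * ‖x‖ := by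
  by_contra! hlt
  have hx : 0 < ‖x‖ := by
    refine norm_pos_iff.2 fun h0 => ?_
    simp [h0] at hlt
  set q := ‖T x‖ / ‖x‖ with hq
  have hMq : M < q := (lt_div_iff₀ hx).2 hlt
  have hq0 : 0 < q := hM.trans_lt hMq
  -- By log-convexity the ratios of successive norms never drop below the first one, `q`. Positivity
  -- is carried along so that a factor can be cancelled.
  have key : ∀ k : ℕ, 0 < ‖(T ^ k) x‖ ∧ q * ‖(T ^ k) x‖ ≤ ‖(T ^ (k + 1)) x‖ := by
    intro k
    induction k with
    | zero => exact ⟨by simpa using hx, by simp [hq, hx.ne']⟩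
    | succ k ih =>
      obtain ⟨h0, h1⟩ := ih
      have h2 : 0 < ‖(T ^ (k + 1)) x‖ := (mul_pos hq0 h0).trans_le h1
      refine ⟨h2, ?_⟩
      have h3 := norm_apply_sq_le_of_isSelfAdjoint hT ((T ^ k) x)
      have e1 : T ((T ^ k) x) = (T ^ (k + 1)) x := by rw [pow_succ']; rfl
      have e2 : T ((T ^ (k + 1)) x) = (T ^ (k + 1 + 1)) x := by rw [pow_succ' T (k + 1)]; rfl
      rw [e1, e2] at h3
      refine le_of_mul_le_mul_right ?_ h0
      calc q * ‖(T ^ (k + 1)) x‖ * ‖(T ^ k) x‖ = (q * ‖(T ^ k) x‖) * ‖(T ^ (k + 1)) x‖ := by ring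
        _ ≤ ‖(T ^ (k + 1)) x‖ * ‖(T ^ (k + 1)) x‖ := by gcongr
        _ = ‖(T ^ (k + 1)) x‖ ^ 2 := by ring
        _ ≤ _ := h3
  have key2 : ∀ k : ℕ, q ^ k * ‖x‖ ≤ ‖(T ^ k) x‖ := by
    intro k
    induction k with
    | zero => simp
    | succ k ih =>
      calc q ^ (k + 1) * ‖x‖ = q * (q ^ k * ‖x‖) := by ring
        _ ≤ q * ‖(T ^ k) x‖ := by gcongr
        _ ≤ _ := (key k).2
  have hlim : Filter.Tendsto (fun k : ℕ => C * (M / q) ^ k) Filter.atTop (nhds (C * 0)) :=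
    (tendsto_pow_atTop_nhds_zero_of_lt_one (div_nonneg hM hq0.le)
      ((div_lt_one hq0).2 hMq)).const_mul C
  have hle : ‖x‖ ≤ C * 0 := by
    refine ge_of_tendsto' hlim fun k => ?_
    rw [div_pow, ← mul_div_assoc, le_div_iff₀ (pow_pos hq0 k), mul_comm]
    exact (key2 k).trans (h k)
  rw [mul_zero] at hle
  exact hx.not_ge hle

/-- The constant may depend on the vector without any uniformity, since only the exponential rate
survives. -/
theorem norm_le_of_pow_growth {T : E →L[ℂ] E} (hT : IsSelfAdjoint T) {M : ℝ} (hM : 0 ≤ M)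
    {s : Set E} (hs : Dense s) (h : ∀ x ∈ s, ∃ C : ℝ, ∀ k : ℕ, ‖(T ^ k) x‖ ≤ C * M ^ k) :
    ‖T‖ ≤ M := by
  refine T.opNorm_le_bound hM fun x => ?_
  have : closure s ⊆ {x | ‖T x‖ ≤ M * ‖x‖} :=
    closure_minimal (fun x hx => norm_apply_le_of_pow_growth hT hM (h x hx).choose_spec)
      (isClosed_le (by fun_prop) (by fun_prop))
  exact this (hs x)

variable {B : Type*} [NormedRing B] [StarRing B] [NormedAlgebra ℂ B] [StarModule ℂ B]

/-- The vectors on which the second components of the elements of `P` are dominated by the first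
components. -/
def dominatedVectors (P : StarSubalgebra ℂ (B × (E →L[ℂ] E))) : Submodule ℂ E where
  carrier := {x | ∃ C : ℝ, ∀ b ∈ P, ‖b.2 x‖ ≤ C * ‖b.1‖}
  zero_mem' := ⟨0, by simp⟩
  add_mem' := by
    rintro x y ⟨C, hC⟩ ⟨D, hD⟩
    refine ⟨C + D, fun b hb => ?_⟩
    rw [map_add, add_mul]
    exact (norm_add_le _ _).trans (add_le_add (hC b hb) (hD b hb))
  smul_mem' := by
    rintro c x ⟨C, hC⟩
    refine ⟨‖c‖ * C, fun b hb => ?_⟩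
    rw [map_smul, norm_smul, mul_assoc]
    exact mul_le_mul_of_nonneg_left (hC b hb) (norm_nonneg c)

/-- `P` is closed under products, so `b.2` only changes the constant, by a factor `‖b.1‖`. -/
theorem apply_mem_dominatedVectors {P : StarSubalgebra ℂ (B × (E →L[ℂ] E))}
    {b : B × (E →L[ℂ] E)} (hb : b ∈ P) {x : E} (hx : x ∈ dominatedVectors P) :
    b.2 x ∈ dominatedVectors P := by
  obtain ⟨C, hC⟩ := hx
  refine ⟨|C| * ‖b.1‖, fun a ha => ?_⟩
  calc ‖a.2 (b.2 x)‖ ≤ C * ‖a.1 * b.1‖ := hC _ (mul_mem ha hb)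
    _ ≤ |C| * ‖a.1 * b.1‖ := mul_le_mul_of_nonneg_right (le_abs_self C) (norm_nonneg _)
    _ ≤ |C| * (‖a.1‖ * ‖b.1‖) := mul_le_mul_of_nonneg_left (norm_mul_le _ _) (abs_nonneg C)
    _ = _ := by ring

theorem apply_mem_closure_dominatedVectors {P : StarSubalgebra ℂ (B × (E →L[ℂ] E))}
    {b : B × (E →L[ℂ] E)} (hb : b ∈ P) {x : E}
    (hx : x ∈ (dominatedVectors P).topologicalClosure) :
    b.2 x ∈ (dominatedVectors P).topologicalClosure :=
  map_mem_closure b.2.continuous hx fun _ h => apply_mem_dominatedVectors hb h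

/-- Apply the bound to `star b * b`: the left side becomes `‖b.2 x‖²`, and the C⋆-identity turns the
right side into `C ‖b.1‖²`. -/
theorem mem_dominatedVectors_of_inner_le [CStarRing B] {P : StarSubalgebra ℂ (B × (E →L[ℂ] E))} {x : E} {C : ℝ}
    (h : ∀ b ∈ P, ‖(inner ℂ (b.2 x) x : ℂ)‖ ≤ C * ‖b.1‖) : x ∈ dominatedVectors P := by
  refine ⟨√|C|, fun b hb => ?_⟩
  have h1 := h (star b * b) (mul_mem (star_mem hb) hb)
  have h2 : (inner ℂ ((star b * b).2 x) x : ℂ) = inner ℂ (b.2 x) (b.2 x) := by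
    change inner ℂ (star b.2 (b.2 x)) x = _
    rw [ContinuousLinearMap.star_eq_adjoint, ContinuousLinearMap.adjoint_inner_left]
  have h3 : ‖(star b * b).1‖ = ‖b.1‖ * ‖b.1‖ := CStarRing.norm_star_mul_self
  rw [h2, h3, inner_self_eq_norm_sq_to_K] at h1
  have h4 : ‖b.2 x‖ ^ 2 ≤ C * (‖b.1‖ * ‖b.1‖) := by simpa using h1
  refine abs_le_of_sq_le_sq' ?_ (by positivity) |>.2
  rw [mul_pow, Real.sq_sqrt (abs_nonneg C), sq ‖b.1‖]
  exact h4.trans (mul_le_mul_of_nonneg_right (le_abs_self C) (by positivity))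

theorem norm_snd_le_norm_fst [CStarRing B] {P : StarSubalgebra ℂ (B × (E →L[ℂ] E))}
    (hP : (dominatedVectors P).topologicalClosure = ⊤) {b : B × (E →L[ℂ] E)} (hb : b ∈ P) :
    ‖b.2‖ ≤ ‖b.1‖ := by
  have hT : IsSelfAdjoint (star b.2 * b.2) := IsSelfAdjoint.star_mul_self b.2
  have h := norm_le_of_pow_growth hT (M := ‖b.1‖ * ‖b.1‖) (by positivity)
    (Submodule.dense_iff_topologicalClosure_eq_top.2 hP) (by
      rintro x ⟨C, hC⟩
      -- `‖x‖` covers `k = 0`, where submultiplicativity gives nothing because `‖1‖ ≤ 1` is not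
      -- assumed in `B`; it also makes the constant nonnegative.
      refine ⟨max C ‖x‖, fun k => ?_⟩
      rcases Nat.eq_zero_or_pos k with rfl | hk
      · simp
      have h1 := hC ((star b * b) ^ k) (pow_mem (mul_mem (star_mem hb) hb) k)
      have h2 : ‖((star b * b) ^ k).1‖ ≤ (‖b.1‖ * ‖b.1‖) ^ k := by
        rw [← CStarRing.norm_star_mul_self (x := b.1)]
        exact norm_pow_le' _ hk
      calc _ ≤ C * ‖((star b * b) ^ k).1‖ := h1
        _ ≤ max C ‖x‖ * ‖((star b * b) ^ k).1‖ :=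
          mul_le_mul_of_nonneg_right (le_max_left _ _) (norm_nonneg _)
        _ ≤ _ := mul_le_mul_of_nonneg_left h2 ((norm_nonneg x).trans (le_max_right _ _)))
  rw [CStarRing.norm_star_mul_self] at h
  exact (mul_self_le_mul_self_iff (norm_nonneg _) (norm_nonneg _)).2 h

end Growth

/-! ### Centered alternating words span the generated algebra -/

section Span

variable {ι : Type u} {A : ι → Type w} [∀ i, CStarAlgebra (A i)]

/-- A product `a₁ ⋯ aₘ` with `aₖ ∈ A iₖ`, `φ aₖ = 0` and `iₖ ≠ iₖ₊₁`. -/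
def IsReduced (φ : ∀ i, A i →ₗ[ℂ] ℂ) (l : List (Σ i, A i)) : Prop :=
  l.IsChain (fun p q => p.1 ≠ q.1) ∧ ∀ p ∈ l, φ p.1 p.2 = 0

variable {B : Type*} [Ring B] [Algebra ℂ B] (j : ∀ i, A i →ₐ[ℂ] B)

/-- The product in `B` of the letters of a word. -/
def evalWord (l : List (Σ i, A i)) : B := (l.map fun p => j p.1 p.2).prod

theorem evalWord_nil : evalWord j [] = 1 := rfl

theorem evalWord_cons (p : Σ i, A i) (l : List (Σ i, A i)) :
    evalWord j (p :: l) = j p.1 p.2 * evalWord j l := by simp [evalWord]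

/-- If the first letter of the word lies in the same `A i`, merge it with `a`. Then split the new
first letter as its centered part plus a scalar; both resulting words are reduced. -/
theorem mul_evalWord_mem_span {φ : ∀ i, A i →ₗ[ℂ] ℂ} (hφ : ∀ i, φ i 1 = 1)
    {l : List (Σ i, A i)} (hl : IsReduced φ l) (i : ι) (a : A i) :
    j i a * evalWord j l ∈ Submodule.span ℂ (evalWord j '' {l | IsReduced φ l}) := by
  have main : ∀ (t : List (Σ i, A i)), IsReduced φ t → (∀ p ∈ t.head?, i ≠ p.1) → ∀ b : A i,
      j i b * evalWord j t ∈ Submodule.span ℂ (evalWord j '' {l | IsReduced φ l}) := by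
    intro t ht hi b
    have h0 : φ i (b - φ i b • 1) = 0 := by simp [hφ]
    have e : j i b * evalWord j t =
        evalWord j (⟨i, b - φ i b • 1⟩ :: t) + φ i b • evalWord j t := by
      simp [evalWord_cons, sub_mul]
    rw [e]
    refine add_mem (Submodule.subset_span ⟨_, ⟨List.isChain_cons.2 ⟨hi, ht.1⟩, ?_⟩, rfl⟩)
      (Submodule.smul_mem _ _ (Submodule.subset_span ⟨_, ht, rfl⟩))
    intro p hp
    rcases List.mem_cons.1 hp with rfl | hp
    · exact h0
    · exact ht.2 p hp
  cases l with
  | nil => exact main [] hl (by simp) a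
  | cons p t =>
    by_cases h : i = p.1
    · subst h
      obtain ⟨h1, h2⟩ := List.isChain_cons.1 hl.1
      rw [evalWord_cons, ← mul_assoc, ← map_mul]
      exact main t ⟨h2, fun q hq => hl.2 q (List.mem_cons_of_mem _ hq)⟩ h1 _
    · exact main (p :: t) hl (by simpa using h) a

theorem adjoin_le_span_evalWord {φ : ∀ i, A i →ₗ[ℂ] ℂ} (hφ : ∀ i, φ i 1 = 1) :
    Subalgebra.toSubmodule (Algebra.adjoin ℂ (⋃ i, Set.range (j i))) ≤
      Submodule.span ℂ (evalWord j '' {l | IsReduced φ l}) := by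
  rw [Algebra.adjoin_eq_span, Submodule.span_le]
  intro x hx
  induction hx using Submonoid.closure_induction_left with
  | one => exact Submodule.subset_span ⟨[], ⟨List.isChain_nil, by simp⟩, rfl⟩
  | mul_left x hx y _ ih =>
    obtain ⟨i, a, rfl⟩ := Set.mem_iUnion.1 hx
    refine Submodule.span_induction (p := fun y _ => j i a * y ∈
      Submodule.span ℂ (evalWord j '' {l | IsReduced φ l})) ?_ ?_ ?_ ?_ ih
    · rintro _ ⟨l, hl, rfl⟩
      exact mul_evalWord_mem_span j hφ hl i a
    · simp
    · intro y z _ _ hy hz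
      rw [mul_add]
      exact add_mem hy hz
    · intro c y _ hy
      rw [mul_smul_comm]
      exact Submodule.smul_mem _ _ hy

end Span

/-! ### Supports of vectors in the free product and the action on them -/

section Support

variable {ι : Type u} (H : ι → Type v) [∀ i, NormedAddCommGroup (H i)]
  [∀ i, InnerProductSpace ℂ (H i)] (ξ : ∀ i, H i)

/-- The closed subspace of the free product spanned by the summands of the words in `T`. -/
def wordSpan (T : Set (Word ι)) : Submodule ℂ (FreeProduct H ξ) :=
  (Submodule.span ℂ {f | ∃ u ∈ T, ∃ z, f = single (Summand H ξ) u z}).topologicalClosure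

theorem single_mem_wordSpan {T : Set (Word ι)} {u : Word ι} (hu : u ∈ T) (z : Summand H ξ u) :
    single (Summand H ξ) u z ∈ wordSpan H ξ T :=
  Submodule.le_topologicalClosure _ (Submodule.subset_span ⟨u, hu, z, rfl⟩)

theorem apply_mem_of_mem_wordSpan {T : Set (Word ι)} {S : Submodule ℂ (FreeProduct H ξ)}
    (hS : IsClosed (S : Set (FreeProduct H ξ))) (F : FreeProduct H ξ →L[ℂ] FreeProduct H ξ)
    (hF : ∀ u ∈ T, ∀ z, F (single (Summand H ξ) u z) ∈ S) {f : FreeProduct H ξ}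
    (hf : f ∈ wordSpan H ξ T) : F f ∈ S := by
  have h : wordSpan H ξ T ≤ S.comap F.toLinearMap := by
    refine Submodule.topologicalClosure_minimal _ (Submodule.span_le.2 ?_)
      (hS.preimage F.continuous)
    rintro _ ⟨u, hu, z, rfl⟩
    exact hF u hu z
  exact h hf

theorem wordSpan_mono {S T : Set (Word ι)} (h : S ⊆ T) : wordSpan H ξ S ≤ wordSpan H ξ T :=
  fun _ hf => apply_mem_of_mem_wordSpan H ξ (Submodule.isClosed_topologicalClosure _)
    (ContinuousLinearMap.id ℂ _) (fun _ hu z => single_mem_wordSpan H ξ (h hu) z) hf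

theorem inner_eq_zero_of_mem_wordSpan {S T : Set (Word ι)} (h : Disjoint S T)
    {f g : FreeProduct H ξ} (hf : f ∈ wordSpan H ξ S) (hg : g ∈ wordSpan H ξ T) :
    inner ℂ f g = 0 := by
  have h1 : wordSpan H ξ S ≤ (wordSpan H ξ T)ᗮ := by
    refine Submodule.topologicalClosure_minimal _ (Submodule.span_le.2 ?_)
      (Submodule.isClosed_orthogonal _)
    rintro _ ⟨u, hu, z, rfl⟩
    have h2 : wordSpan H ξ T ≤ (ℂ ∙ single (Summand H ξ) u z)ᗮ := by
      refine Submodule.topologicalClosure_minimal _ (Submodule.span_le.2 ?_)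
        (Submodule.isClosed_orthogonal _)
      rintro _ ⟨u', hu', z', rfl⟩
      refine Submodule.mem_orthogonal_singleton_iff_inner_right.2 ?_
      have huu : u ≠ u' := by
        rintro rfl
        exact Set.disjoint_left.1 h hu hu'
      exact inner_single_ne _ huu _ _
    intro g hg
    exact inner_eq_zero_symm.1 (Submodule.mem_orthogonal_singleton_iff_inner_right.1 (h2 hg))
  exact inner_eq_zero_symm.1 (h1 hf g hg)

theorem eq_top_of_forall_single_mem {S : Submodule ℂ (FreeProduct H ξ)}
    (hS : IsClosed (S : Set (FreeProduct H ξ)))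
    (h : ∀ u z, single (Summand H ξ) u z ∈ S) : S = ⊤ := by
  refine eq_top_iff.2 fun f _ => ?_
  exact hS.mem_of_tendsto (hasSum_single (Summand H ξ) f)
    (Filter.Eventually.of_forall fun s => S.sum_mem fun w _ => h w _)

theorem canonicalBilin_single {i : ι} (h : H i) (w : WordNot i) (z : Summand H ξ w.1) :
    canonicalBilin H ξ i h (single (fun w : WordNot i => Summand H ξ w.1) w z) =
      (inner ℂ (ξ i) h : ℂ) • single (Summand H ξ) w.1 z +
        single (Summand H ξ) w.cons
          (consIso H ξ w (tmul ((ℂ ∙ ξ i)ᗮ.orthogonalProjectionOnto h) z)) := by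
  rw [canonicalBilin_apply, inclNot, sumMap_single, tensorLeft_single, inclCons, sumMap_single]
  rfl

theorem canonicalBilin_single_mem_wordSpan {i : ι} (h : H i) (w : WordNot i)
    (z : Summand H ξ w.1) :
    canonicalBilin H ξ i h (single (fun w : WordNot i => Summand H ξ w.1) w z) ∈
      wordSpan H ξ {w.1, w.cons} := by
  have h1 : w.1 ∈ ({w.1, w.cons} : Set (Word ι)) := Set.mem_insert _ _
  have h2 : w.cons ∈ ({w.1, w.cons} : Set (Word ι)) := Set.mem_insert_of_mem _ rfl
  rw [canonicalBilin_single]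
  exact add_mem (Submodule.smul_mem _ _ (single_mem_wordSpan H ξ h1 _))
    (single_mem_wordSpan H ξ h2 _)

theorem canonicalBilin_single_mem_wordSpan_of_inner_eq_zero {i : ι} {h : H i}
    (hh : inner ℂ (ξ i) h = (0 : ℂ)) (w : WordNot i) (z : Summand H ξ w.1) :
    canonicalBilin H ξ i h (single (fun w : WordNot i => Summand H ξ w.1) w z) ∈
      wordSpan H ξ {w.cons} := by
  rw [canonicalBilin_single, hh, zero_smul, zero_add]
  exact single_mem_wordSpan H ξ (Set.mem_singleton w.cons) _

theorem continuous_canonicalBilin_left (hξ : ∀ i, ‖ξ i‖ = 1) (i : ι) (ζ : FreeProductNot H ξ i) :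
    Continuous fun h => canonicalBilin H ξ i h ζ := by
  have : (fun h => canonicalBilin H ξ i h ζ) =
      fun h => canonicalIsometry H ξ hξ i (tmul h ζ) := by
    funext h
    rw [canonicalIsometry, liftIsometry_tmul]
  rw [this]
  exact (LinearIsometry.continuous _).comp (by fun_prop)

variable [∀ i, CompleteSpace (H i)] (hξ : ∀ i, ‖ξ i‖ = 1)

/-- The vector is `U (h ⊗ ζ)`, and `U (T ⊗ Id) U*` changes only the first leg. -/
theorem freeAction_canonicalBilin (i : ι) (T : H i →L[ℂ] H i) (h : H i)
    (ζ : FreeProductNot H ξ i) :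
    freeAction H ξ hξ i T (canonicalBilin H ξ i h ζ) = canonicalBilin H ξ i (T h) ζ := by
  have e : ∀ h, canonicalBilin H ξ i h ζ = canonicalIso H ξ hξ i (tmul h ζ) := by
    intro h
    change _ = canonicalIsometry H ξ hξ i (tmul h ζ)
    rw [canonicalIsometry, liftIsometry_tmul]
  rw [e, e, ← tensorId_tmul]
  change canonicalIso H ξ hξ i (tensorId _ T ((canonicalIso H ξ hξ i).symm _)) = _
  rw [LinearIsometryEquiv.symm_apply_apply]

theorem freeAction_single {i : ι} (T : H i →L[ℂ] H i) (w : WordNot i) (z : Summand H ξ w.1) :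
    freeAction H ξ hξ i T (single (Summand H ξ) w.1 z) =
      canonicalBilin H ξ i (T (ξ i)) (single (fun w : WordNot i => Summand H ξ w.1) w z) := by
  rw [← freeAction_canonicalBilin H ξ hξ]
  congr 1
  rw [← canonicalIsometry_distinguished H ξ hξ, canonicalIsometry, liftIsometry_tmul]

/-- An operator on `H i` with vanishing vacuum expectation maps the summands of words not starting
with `i` to those of the words prolonged by `i`. -/
theorem freeAction_mem_wordSpan {i : ι} {T : H i →L[ℂ] H i} (hT : inner ℂ (ξ i) (T (ξ i)) = (0 : ℂ))
    {S S' : Set (Word ι)} (hS : ∀ u ∈ S, ∃ w : WordNot i, w.1 = u ∧ w.cons ∈ S')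
    {f : FreeProduct H ξ} (hf : f ∈ wordSpan H ξ S) :
    freeAction H ξ hξ i T f ∈ wordSpan H ξ S' := by
  refine apply_mem_of_mem_wordSpan H ξ (Submodule.isClosed_topologicalClosure _) _ ?_ hf
  intro u hu z
  obtain ⟨w, rfl, hw⟩ := hS u hu
  rw [freeAction_single]
  exact wordSpan_mono H ξ (Set.singleton_subset_iff.2 hw)
    (canonicalBilin_single_mem_wordSpan_of_inner_eq_zero H ξ hT w z)

end Support

/-! ### Compressions of reduced words and conditional expectations -/

section Compression

variable {ι : Type u}

theorem map_evalWord {A : ι → Type w} [∀ i, CStarAlgebra (A i)] {B C : Type*} [Ring B] [Algebra ℂ B]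
    [Ring C] [Algebra ℂ C] (f : B →ₐ[ℂ] C) (j : ∀ i, A i →ₐ[ℂ] B) (l : List (Σ i, A i)) :
    f (evalWord j l) = evalWord (fun i => f.comp (j i)) l := by
  induction l with
  | nil => simp [evalWord_nil]
  | cons p l ih => simp [evalWord_cons, ih]

open scoped Classical in
/-- The conditional expectation onto `A i` of a reduced word: the word itself if it is `1` or
consists of a single letter from `A i`, and zero otherwise. -/
def expectation {A : ι → Type w} [∀ i, CStarAlgebra (A i)] (i : ι) (l : List (Σ i, A i)) : A i :=
  if h : ∃ a : A i, l = [⟨i, a⟩] then h.choose else if l = [] then 1 else 0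

variable {H : ι → Type v} [∀ i, NormedAddCommGroup (H i)] [∀ i, InnerProductSpace ℂ (H i)]
  [∀ i, CompleteSpace (H i)] {A : ι → Type w} [∀ i, CStarAlgebra (A i)]
  (π : ∀ i, A i →⋆ₐ[ℂ] (H i →L[ℂ] H i)) {ξ : ∀ i, H i} (hξ : ∀ i, ‖ξ i‖ = 1)

variable (ξ) in
/-- The vector functional `a ↦ ⟪ξ i, a ξ i⟫`. -/
def vectorState (i : ι) : A i →ₗ[ℂ] ℂ where
  toFun a := inner ℂ (ξ i) (π i a (ξ i))
  map_add' a b := by simp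
  map_smul' c a := by simp

theorem vectorState_apply (i : ι) (a : A i) :
    vectorState π ξ i a = inner ℂ (ξ i) (π i a (ξ i)) := rfl

include hξ in
theorem vectorState_one (i : ι) : vectorState π ξ i 1 = 1 := by
  simp [vectorState_apply, hξ]

/-- The action of `A i` on the free product. -/
def leftAction (i : ι) : A i →⋆ₐ[ℂ] (FreeProduct H ξ →L[ℂ] FreeProduct H ξ) :=
  (freeAction H ξ hξ i).comp (π i)

theorem leftAction_canonicalBilin (i : ι) (a : A i) (h : H i) (ζ : FreeProductNot H ξ i) :
    leftAction π hξ i a (canonicalBilin H ξ i h ζ) = canonicalBilin H ξ i (π i a h) ζ :=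
  freeAction_canonicalBilin H ξ hξ i _ _ _

/-- `T` supports `M ⊗ ζ`, and `Q` collects the words reached after leaving it. Letters act from the
right: at most one letter of `A i` acts inside `M ⊗ ζ`, the next has another index and moves into
`Q`, and each later letter prolongs the words. Recording the first letter `p.1` in the conclusion
lets the induction see that the next letter can be prepended. -/
theorem evalWord_mem_wordSpan {i : ι} {T Q : Set (Word ι)} {M : Submodule ℂ (H i)}
    {ζ : FreeProductNot H ξ i} (hM : ∀ a, ∀ h ∈ M, π i a h ∈ M)
    (hT : ∀ h ∈ M, canonicalBilin H ξ i h ζ ∈ wordSpan H ξ T)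
    (hTQ : ∀ j ≠ i, ∀ u ∈ T, ∃ w : WordNot j, w.1 = u ∧ w.cons ∈ Q)
    (hQ : ∀ j, ∀ u : WordNot j, u.1 ∈ Q → u.cons ∈ Q) {h : H i} (hh : h ∈ M)
    (p : Σ i, A i) (t : List (Σ i, A i)) (hl : IsReduced (vectorState π ξ) (p :: t))
    (hne : ∀ a, p :: t ≠ [⟨i, a⟩]) :
    evalWord (fun i => (leftAction π hξ i).toAlgHom) (p :: t) (canonicalBilin H ξ i h ζ) ∈
      wordSpan H ξ {u | u ∈ Q ∧ u.1.head? = some p.1} := by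
  have base : ∀ p : Σ i, A i, inner ℂ (ξ p.1) (π p.1 p.2 (ξ p.1)) = (0 : ℂ) → p.1 ≠ i →
      ∀ h ∈ M, leftAction π hξ p.1 p.2 (canonicalBilin H ξ i h ζ) ∈
        wordSpan H ξ {u | u ∈ Q ∧ u.1.head? = some p.1} := by
    intro p hp hpi h hh
    refine freeAction_mem_wordSpan H ξ hξ hp ?_ (hT h hh)
    intro u hu
    obtain ⟨w, hw, hwQ⟩ := hTQ p.1 hpi u hu
    exact ⟨w, hw, hwQ, rfl⟩
  induction t generalizing p with
  | nil =>
    have hpi : p.1 ≠ i := by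
      obtain ⟨j, a⟩ := p
      rintro rfl
      exact hne a rfl
    rw [evalWord_cons, evalWord_nil, mul_one]
    exact base p (hl.2 p List.mem_cons_self) hpi h hh
  | cons q t ih =>
    obtain ⟨hc, hl'⟩ := List.isChain_cons.1 hl.1
    have hp : inner ℂ (ξ p.1) (π p.1 p.2 (ξ p.1)) = (0 : ℂ) := hl.2 p List.mem_cons_self
    have hpq : p.1 ≠ q.1 := hc q rfl
    rw [evalWord_cons]
    -- A lone letter of `A i` has not left `M ⊗ ζ`, so the induction hypothesis does not apply; `p`,
    -- with index different from `i`, is then the first letter to leave.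
    by_cases hq : ∃ a, q :: t = [⟨i, a⟩]
    · obtain ⟨a, ha⟩ := hq
      obtain ⟨rfl, rfl⟩ := List.cons_eq_cons.1 ha
      rw [evalWord_cons, evalWord_nil, mul_one]
      change leftAction π hξ p.1 p.2 (leftAction π hξ i a _) ∈ _
      rw [leftAction_canonicalBilin]
      exact base p hp hpq _ (hM a h hh)
    · have hr : IsReduced (vectorState π ξ) (q :: t) :=
        ⟨hl', fun r hr => hl.2 r (List.mem_cons_of_mem _ hr)⟩
      refine freeAction_mem_wordSpan H ξ hξ hp ?_ (ih q hr fun a ha => hq ⟨a, ha⟩)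
      rintro u ⟨huQ, hu⟩
      refine ⟨⟨u, ?_⟩, rfl, hQ _ _ huQ, rfl⟩
      rw [hu]
      exact fun e => hpq (Option.some_injective _ e).symm

/-- The compression of reduced words to the copy `M ⊗ ζ` of a subspace `M` of `H i` in the free
product is given by the conditional expectation onto `A i`. -/
def IsExpected (i : ι) (M : Submodule ℂ (H i)) (ζ : FreeProductNot H ξ i) : Prop :=
  ∀ l : List (Σ i, A i), IsReduced (vectorState π ξ) l → ∀ h ∈ M, ∀ h' ∈ M,
    inner ℂ (canonicalBilin H ξ i h' ζ) (evalWord (fun i => (leftAction π hξ i).toAlgHom) l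
      (canonicalBilin H ξ i h ζ)) = inner ℂ h' (π i (expectation i l) h) * inner ℂ ζ ζ

/-- The empty word and single letters of `A i` act on the first leg of `M ⊗ ζ`. Any other reduced
word moves it into the span of `Q`, orthogonal to it. -/
theorem isExpected_of_disjoint {i : ι} {T Q : Set (Word ι)} {M : Submodule ℂ (H i)}
    {ζ : FreeProductNot H ξ i} (hM : ∀ a, ∀ h ∈ M, π i a h ∈ M)
    (hT : ∀ h ∈ M, canonicalBilin H ξ i h ζ ∈ wordSpan H ξ T)
    (hTQ : ∀ j ≠ i, ∀ u ∈ T, ∃ w : WordNot j, w.1 = u ∧ w.cons ∈ Q)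
    (hQ : ∀ j, ∀ u : WordNot j, u.1 ∈ Q → u.cons ∈ Q) (hd : Disjoint T Q) :
    IsExpected π hξ i M ζ := by
  intro l hl h hh h' hh'
  by_cases hl1 : ∃ a : A i, l = [⟨i, a⟩]
  · have e : l = [⟨i, expectation i l⟩] := by
      rw [expectation, dif_pos hl1]
      exact hl1.choose_spec
    have e' : evalWord (fun i => (leftAction π hξ i).toAlgHom) l =
        leftAction π hξ i (expectation i l) := by
      conv_lhs => rw [e]
      rw [evalWord_cons, evalWord_nil, mul_one]
      rfl
    rw [e', leftAction_canonicalBilin, inner_canonicalBilin H ξ hξ]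
  · cases l with
    | nil =>
      rw [expectation, dif_neg hl1, if_pos rfl, map_one, evalWord_nil]
      exact inner_canonicalBilin H ξ hξ i h' h ζ ζ
    | cons p t =>
      have e : expectation i (p :: t) = 0 := by
        rw [expectation, dif_neg hl1, if_neg (by simp)]
      have h1 := evalWord_mem_wordSpan π hξ hM hT hTQ hQ hh p t hl fun a ha => hl1 ⟨a, ha⟩
      rw [e, map_zero, zero_apply, inner_zero_right, zero_mul]
      refine inner_eq_zero_of_mem_wordSpan H ξ ?_ (hT h' hh') h1
      exact hd.mono_right fun u hu => hu.1

variable (ι) in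
/-- The empty word. -/
def emptyWord : Word ι := ⟨[], List.isChain_nil⟩

/-- The empty word, as a word not starting with `i`. -/
def emptyWordNot (i : ι) : WordNot i := ⟨emptyWord ι, by simp [emptyWord]⟩

/-- `H i ⊗ Ω` lives on the words `∅` and `i` only, and prepending a letter other than `i` leaves
these for good. -/
theorem isExpected_top (i : ι) (z : Summand H ξ (emptyWord ι)) :
    IsExpected π hξ i ⊤ (single (fun w : WordNot i => Summand H ξ w.1) (emptyWordNot i) z) := by
  refine isExpected_of_disjoint π hξ (T := {(emptyWordNot i).1, (emptyWordNot i).cons})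
    (Q := {u | u.1 ≠ [] ∧ u.1 ≠ [i]}) (fun _ _ _ => trivial)
    (fun h _ => canonicalBilin_single_mem_wordSpan H ξ h (emptyWordNot i) z) ?_ ?_ ?_
  · rintro j hj u (rfl | rfl)
    · refine ⟨emptyWordNot j, rfl, ?_⟩
      simpa [WordNot.cons, emptyWordNot, emptyWord] using hj
    · refine ⟨⟨(emptyWordNot i).cons, ?_⟩, rfl, ?_⟩
      · simpa [WordNot.cons, emptyWordNot, emptyWord] using hj.symm
      · simp [WordNot.cons, emptyWordNot, emptyWord]
  · rintro j u ⟨hu, -⟩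
    exact ⟨by simp [WordNot.cons], by simp [WordNot.cons, hu]⟩
  · refine Set.disjoint_left.2 ?_
    rintro u (rfl | rfl) ⟨h1, h2⟩
    · exact h1 rfl
    · exact h2 rfl

variable (ξ) in
/-- The linear span of the vectors `π i a (ξ i)`. -/
def cyclicSpan (i : ι) : Submodule ℂ (H i) :=
  Submodule.span ℂ (Set.range fun a : A i => π i a (ξ i))

theorem mem_cyclicSpan_orthogonal {i : ι} {h : H i} :
    h ∈ (cyclicSpan π ξ i)ᗮ ↔ ∀ a : A i, inner ℂ (π i a (ξ i)) h = (0 : ℂ) := by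
  refine ⟨fun hh a => hh _ (Submodule.subset_span ⟨a, rfl⟩), fun hh => ?_⟩
  have : cyclicSpan π ξ i ≤ (ℂ ∙ h)ᗮ := by
    refine Submodule.span_le.2 ?_
    rintro _ ⟨a, rfl⟩
    exact Submodule.mem_orthogonal_singleton_iff_inner_left.2 (hh a)
  exact fun x hx => Submodule.mem_orthogonal_singleton_iff_inner_left.1 (this hx)

/-- `M` is invariant and orthogonal to `ξ i`, so `M ⊗ ζ` sits on the single word `i w`, and letters
outside `A i` lengthen it. Without this orthogonality a component on `w` would appear, which such
letters need not lengthen. -/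
theorem isExpected_cyclicSpan_orthogonal (i : ι) (w : WordNot i) (z : Summand H ξ w.1) :
    IsExpected π hξ i (cyclicSpan π ξ i)ᗮ
      (single (fun w : WordNot i => Summand H ξ w.1) w z) := by
  refine isExpected_of_disjoint π hξ (T := {w.cons})
    (Q := {u | w.1.1.length + 1 < u.1.length}) ?_ ?_ ?_ ?_ ?_
  · intro a h hh
    rw [mem_cyclicSpan_orthogonal] at hh ⊢
    intro b
    have := hh (star a * b)
    rwa [map_mul, map_star, ContinuousLinearMap.star_eq_adjoint, mul_apply_eq_comp,
      ContinuousLinearMap.adjoint_inner_left] at this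
  · intro h hh
    refine canonicalBilin_single_mem_wordSpan_of_inner_eq_zero H ξ ?_ w z
    simpa using (mem_cyclicSpan_orthogonal π).1 hh 1
  · rintro j hj u rfl
    refine ⟨⟨w.cons, ?_⟩, rfl, ?_⟩
    · simpa [WordNot.cons] using hj.symm
    · simp [WordNot.cons]
  · intro j u hu
    exact Nat.lt_succ_of_lt hu
  · refine Set.disjoint_left.2 ?_
    rintro u rfl hu
    exact lt_irrefl (w.1.1.length + 1) hu

end Compression

/-! ### Comparison of the two free products -/

section Comparison

universe v'

variable {ι : Type u} {A : ι → Type w} [∀ i, CStarAlgebra (A i)]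
  {H : ι → Type v} [∀ i, NormedAddCommGroup (H i)] [∀ i, InnerProductSpace ℂ (H i)]
  [∀ i, CompleteSpace (H i)] (π : ∀ i, A i →⋆ₐ[ℂ] (H i →L[ℂ] H i)) {ξ : ∀ i, H i}
  (hξ : ∀ i, ‖ξ i‖ = 1)
  {H' : ι → Type v'} [∀ i, NormedAddCommGroup (H' i)] [∀ i, InnerProductSpace ℂ (H' i)]
  [∀ i, CompleteSpace (H' i)] (π' : ∀ i, A i →⋆ₐ[ℂ] (H' i →L[ℂ] H' i)) {ξ' : ∀ i, H' i}
  (hξ' : ∀ i, ‖ξ' i‖ = 1)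

/-- The `*`-algebra generated by the pairs of copies of the elements of the `A i` on two free
products. -/
def pairAlgebra : StarSubalgebra ℂ
    ((FreeProduct H ξ →L[ℂ] FreeProduct H ξ) × (FreeProduct H' ξ' →L[ℂ] FreeProduct H' ξ')) :=
  StarAlgebra.adjoin ℂ
    (⋃ i, Set.range fun a : A i => (leftAction π hξ i a, leftAction π' hξ' i a))

theorem leftAction_mem_pairAlgebra (i : ι) (a : A i) :
    (leftAction π hξ i a, leftAction π' hξ' i a) ∈ pairAlgebra π hξ π' hξ' :=
  StarAlgebra.subset_adjoin ℂ _ (Set.mem_iUnion.2 ⟨i, a, rfl⟩)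

/-- The generating set is already closed under `star`. -/
theorem pairAlgebra_toSubalgebra : (pairAlgebra π hξ π' hξ').toSubalgebra =
    Algebra.adjoin ℂ (⋃ i, Set.range
      ((leftAction π hξ i).toAlgHom.prod (leftAction π' hξ' i).toAlgHom)) := by
  rw [pairAlgebra, StarAlgebra.adjoin_toSubalgebra]
  congr 1
  refine Set.union_eq_left.2 fun x hx => ?_
  obtain ⟨i, a, ha⟩ := Set.mem_iUnion.1 hx
  refine Set.mem_iUnion.2 ⟨i, star a, ?_⟩
  rw [← star_star x, ← ha]
  exact Prod.ext (map_star _ _) (map_star _ _)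

/-- Equal states make the same words reduced on both sides, with the same expectation. Asking for
one `a` serving every compression at once lets the claim pass to linear combinations without a
well-defined expectation on `P`. -/
theorem exists_expectation (hφ : vectorState π ξ = vectorState π' ξ')
    {x : (FreeProduct H ξ →L[ℂ] FreeProduct H ξ) × (FreeProduct H' ξ' →L[ℂ] FreeProduct H' ξ')}
    (hx : x ∈ pairAlgebra π hξ π' hξ') (i : ι) :
    ∃ a : A i,
      (∀ M ζ, IsExpected π hξ i M ζ → ∀ h ∈ M, ∀ h' ∈ M,
        inner ℂ (canonicalBilin H ξ i h' ζ) (x.1 (canonicalBilin H ξ i h ζ)) =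
          inner ℂ h' (π i a h) * inner ℂ ζ ζ) ∧
      (∀ M ζ, IsExpected π' hξ' i M ζ → ∀ h ∈ M, ∀ h' ∈ M,
        inner ℂ (canonicalBilin H' ξ' i h' ζ) (x.2 (canonicalBilin H' ξ' i h ζ)) =
          inner ℂ h' (π' i a h) * inner ℂ ζ ζ) := by
  have hx' : x ∈ Subalgebra.toSubmodule (pairAlgebra π hξ π' hξ').toSubalgebra := hx
  rw [pairAlgebra_toSubalgebra] at hx'
  have hx'' := adjoin_le_span_evalWord
    (fun i => (leftAction π hξ i).toAlgHom.prod (leftAction π' hξ' i).toAlgHom)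
    (vectorState_one π hξ) hx'
  clear hx hx'
  induction hx'' using Submodule.span_induction with
  | mem x hx =>
    obtain ⟨l, hl, rfl⟩ := hx
    have hl' : IsReduced (vectorState π' ξ') l := hφ ▸ hl
    refine ⟨expectation i l, fun M ζ hM h hh h' hh' => ?_, fun M ζ hM h hh h' hh' => ?_⟩
    · rw [← hM l hl h hh h' hh']
      congr 2
      exact map_evalWord (B := ((FreeProduct H ξ →L[ℂ] FreeProduct H ξ) ×
        (FreeProduct H' ξ' →L[ℂ] FreeProduct H' ξ')))
        (AlgHom.fst ℂ _ _) _ l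
    · rw [← hM l hl' h hh h' hh']
      congr 2
      exact map_evalWord (B := ((FreeProduct H ξ →L[ℂ] FreeProduct H ξ) ×
        (FreeProduct H' ξ' →L[ℂ] FreeProduct H' ξ')))
        (AlgHom.snd ℂ _ _) _ l
  | zero => exact ⟨0, by simp, by simp⟩
  | add x y _ _ hx hy =>
    obtain ⟨a, ha, ha'⟩ := hx
    obtain ⟨b, hb, hb'⟩ := hy
    refine ⟨a + b, fun M ζ hM h hh h' hh' => ?_, fun M ζ hM h hh h' hh' => ?_⟩
    · rw [map_add, Prod.fst_add, add_apply, add_apply, inner_add_right, inner_add_right, add_mul,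
        ha M ζ hM h hh h' hh', hb M ζ hM h hh h' hh']
    · rw [map_add, Prod.snd_add, add_apply, add_apply, inner_add_right, inner_add_right, add_mul,
        ha' M ζ hM h hh h' hh', hb' M ζ hM h hh h' hh']
  | smul c x _ hx =>
    obtain ⟨a, ha, ha'⟩ := hx
    refine ⟨c • a, fun M ζ hM h hh h' hh' => ?_, fun M ζ hM h hh h' hh' => ?_⟩
    · rw [map_smul, Prod.smul_fst, smul_apply, smul_apply, inner_smul_right, inner_smul_right,
        mul_assoc, ha M ζ hM h hh h' hh']
    · rw [map_smul, Prod.smul_snd, smul_apply, smul_apply, inner_smul_right, inner_smul_right,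
        mul_assoc, ha' M ζ hM h hh h' hh']

theorem norm_canonicalBilin {H : ι → Type v} [∀ i, NormedAddCommGroup (H i)]
    [∀ i, InnerProductSpace ℂ (H i)] {ξ : ∀ i, H i} (hξ : ∀ i, ‖ξ i‖ = 1) (i : ι) (h : H i)
    (ζ : FreeProductNot H ξ i) : ‖canonicalBilin H ξ i h ζ‖ = ‖h‖ * ‖ζ‖ := by
  rw [← norm_tmul, ← (canonicalIsometry H ξ hξ i).norm_map, canonicalIsometry, liftIsometry_tmul]

theorem exists_norm_eq_one_emptyWord (H : ι → Type v) [∀ i, NormedAddCommGroup (H i)]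
    [∀ i, InnerProductSpace ℂ (H i)] (ξ : ∀ i, H i) :
    ∃ z : Summand H ξ (emptyWord ι), ‖z‖ = 1 := by
  refine ⟨(EuclideanSpace.single PUnit.unit 1 : EuclideanSpace ℂ PUnit.{v + 1}), ?_⟩
  change ‖(EuclideanSpace.single PUnit.unit 1 : EuclideanSpace ℂ PUnit.{v + 1})‖ = 1
  simp

/-- The diagonal coefficient of `x.2` at `h ⊗ ζ` is that of `π' i a` at `h`, scaled by `‖ζ‖²`; it is
controlled by `‖a‖ ≤ ‖x.1‖`. -/
theorem canonicalBilin_mem_dominatedVectors (hπ : ∀ i, Function.Injective (π i))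
    (hφ : vectorState π ξ = vectorState π' ξ') {i : ι} {M : Submodule ℂ (H' i)}
    {ζ : FreeProductNot H' ξ' i} (hM : IsExpected π' hξ' i M ζ) {h : H' i} (hh : h ∈ M) :
    canonicalBilin H' ξ' i h ζ ∈ dominatedVectors (pairAlgebra π hξ π' hξ') := by
  refine mem_dominatedVectors_of_inner_le (C := ‖h‖ * ‖h‖ * (‖ζ‖ * ‖ζ‖)) fun x hx => ?_
  obtain ⟨a, ha, ha'⟩ := exists_expectation π hξ π' hξ' hφ hx i
  -- Faithfulness makes `π i` isometric, and `π i a` is the compression of `x.1` to `H i ⊗ Ω`;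
  -- testing against `π i a k` recovers its norm.
  have hax : ‖a‖ ≤ ‖x.1‖ := by
    rw [← NonUnitalStarAlgHom.norm_map (π i) (hπ i) a]
    refine (π i a).opNorm_le_bound (norm_nonneg _) fun k => ?_
    obtain ⟨z, hz⟩ := exists_norm_eq_one_emptyWord H ξ
    set η := single (fun w : WordNot i => Summand H ξ w.1) (emptyWordNot i) z
    have hη : ‖η‖ = 1 :=
      ((single (fun w : WordNot i => Summand H ξ w.1) (emptyWordNot i)).norm_map z).trans hz
    have h1 := ha ⊤ η (isExpected_top π hξ i z) k trivial (π i a k) trivial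
    have h2 : ‖π i a k‖ * ‖π i a k‖ ≤ ‖π i a k‖ * (‖x.1‖ * ‖k‖) := by
      have h3 := norm_inner_le_norm (𝕜 := ℂ) (canonicalBilin H ξ i (π i a k) η)
        (x.1 (canonicalBilin H ξ i k η))
      have h4 := x.1.le_opNorm (canonicalBilin H ξ i k η)
      rw [norm_canonicalBilin hξ, hη, mul_one] at h3 h4
      rw [h1, inner_self_eq_norm_sq_to_K, inner_self_eq_norm_sq_to_K, hη] at h3
      refine le_trans ?_ (h3.trans (mul_le_mul_of_nonneg_left h4 (norm_nonneg _)))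
      simp [sq]
    rcases (norm_nonneg (π i a k)).eq_or_lt with h0 | h0
    · rw [← h0]
      positivity
    · exact le_of_mul_le_mul_left h2 h0
  have h1 : ‖(inner ℂ h (π' i a h) : ℂ)‖ ≤ ‖h‖ * (‖x.1‖ * ‖h‖) :=
    (norm_inner_le_norm _ _).trans (mul_le_mul_of_nonneg_left
      (((π' i a).le_opNorm h).trans (mul_le_mul_of_nonneg_right
        ((NonUnitalStarAlgHom.norm_apply_le (π' i) a).trans hax) (norm_nonneg h))) (norm_nonneg h))
  have h2 : ‖(inner ℂ ζ ζ : ℂ)‖ = ‖ζ‖ * ‖ζ‖ := by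
    rw [inner_self_eq_norm_sq_to_K]
    simp [sq]
  rw [← inner_conj_symm, RCLike.norm_conj, ha' M ζ hM h hh h hh, norm_mul, h2]
  calc _ ≤ ‖h‖ * (‖x.1‖ * ‖h‖) * (‖ζ‖ * ‖ζ‖) := mul_le_mul_of_nonneg_right h1 (by positivity)
    _ = _ := by ring

/-- Induction step of the density argument: `h` is split along the closed cyclic subspace and its
orthogonal complement. -/
theorem canonicalBilin_mem_closure_dominatedVectors (hπ : ∀ i, Function.Injective (π i))
    (hφ : vectorState π ξ = vectorState π' ξ') {i : ι} (w : WordNot i) {z : Summand H' ξ' w.1}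
    (hz : single (Summand H' ξ') w.1 z ∈
      (dominatedVectors (pairAlgebra π hξ π' hξ')).topologicalClosure) (h : H' i) :
    canonicalBilin H' ξ' i h (single (fun w : WordNot i => Summand H' ξ' w.1) w z) ∈
      (dominatedVectors (pairAlgebra π hξ π' hξ')).topologicalClosure := by
  set D := (dominatedVectors (pairAlgebra π hξ π' hξ')).topologicalClosure
  set ζ := single (fun w : WordNot i => Summand H' ξ' w.1) w z
  let K : Submodule ℂ (H' i) := D.comap ((canonicalBilin H' ξ' i).flip ζ)
  have hK : IsClosed (K : Set (H' i)) :=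
    (Submodule.isClosed_topologicalClosure _).preimage
      (continuous_canonicalBilin_left H' ξ' hξ' i ζ)
  have h1 : (cyclicSpan π' ξ' i).topologicalClosure ≤ K := by
    refine Submodule.topologicalClosure_minimal _ (Submodule.span_le.2 ?_) hK
    rintro _ ⟨a, rfl⟩
    change canonicalBilin H' ξ' i (π' i a (ξ' i)) ζ ∈ D
    rw [← freeAction_single H' ξ' hξ']
    exact apply_mem_closure_dominatedVectors (leftAction_mem_pairAlgebra π hξ π' hξ' i a) hz
  have h2 : (cyclicSpan π' ξ' i).topologicalClosureᗮ ≤ K := by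
    rw [Submodule.orthogonal_closure]
    intro k hk
    exact Submodule.le_topologicalClosure _ (canonicalBilin_mem_dominatedVectors π hξ π' hξ' hπ hφ
      (isExpected_cyclicSpan_orthogonal π' hξ' i w z) hk)
  have : CompleteSpace (cyclicSpan π' ξ' i).topologicalClosure :=
    (Submodule.isClosed_topologicalClosure _).completeSpace_coe
  have h3 : K = ⊤ := by
    rw [eq_top_iff, ← Submodule.sup_orthogonal_of_hasOrthogonalProjection
      (K := (cyclicSpan π' ξ' i).topologicalClosure)]
    exact sup_le h1 h2
  have h4 : h ∈ K := h3 ▸ Submodule.mem_top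
  exact h4

theorem closure_dominatedVectors_eq_top [Nonempty ι] (hπ : ∀ i, Function.Injective (π i))
    (hφ : vectorState π ξ = vectorState π' ξ') :
    (dominatedVectors (pairAlgebra π hξ π' hξ')).topologicalClosure = ⊤ := by
  refine eq_top_of_forall_single_mem H' ξ' (Submodule.isClosed_topologicalClosure _) ?_
  rintro ⟨l, hl⟩
  induction l with
  | nil =>
    intro z
    obtain ⟨i⟩ := ‹Nonempty ι›
    -- A vacuum vector `z` equals `ξ' i ⊗ z`, so it lies in `H' i ⊗ Ω`; this is where an index is
    -- needed.
    have h := canonicalBilin_mem_dominatedVectors π hξ π' hξ' hπ hφ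
      (isExpected_top π' hξ' i z) (Submodule.mem_top (x := ξ' i))
    have e := canonicalIsometry_distinguished H' ξ' hξ' (emptyWordNot i) z
    rw [canonicalIsometry, liftIsometry_tmul] at e
    rw [e] at h
    exact Submodule.le_topologicalClosure _ h
  | cons i l ih =>
    obtain ⟨h1, h2⟩ := List.isChain_cons.1 hl
    let w : WordNot i := ⟨⟨l, h2⟩, fun h => h1 _ h rfl⟩
    intro z
    change single (Summand H' ξ') w.cons z ∈ _
    obtain ⟨y, rfl⟩ := (consIso H' ξ' w).surjective z
    refine hilbertTensor_induction
      (p := fun y => single (Summand H' ξ') w.cons (consIso H' ξ' w y) ∈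
        (dominatedVectors (pairAlgebra π hξ π' hξ')).topologicalClosure)
      ((Submodule.isClosed_topologicalClosure _).preimage
        ((LinearIsometry.continuous _).comp (LinearIsometryEquiv.continuous _)))
      (by simp) (fun a b ha hb => by simpa only [map_add] using add_mem ha hb)
      (fun h x => ?_) y
    rw [← canonicalIsometry_centered H' ξ' hξ', canonicalIsometry, liftIsometry_tmul]
    exact canonicalBilin_mem_closure_dominatedVectors π hξ π' hξ' hπ hφ w (ih h2 x) h

theorem norm_snd_le_norm_fst_of_mem_pairAlgebra (hπ : ∀ i, Function.Injective (π i))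
    (hφ : vectorState π ξ = vectorState π' ξ')
    {x : (FreeProduct H ξ →L[ℂ] FreeProduct H ξ) × (FreeProduct H' ξ' →L[ℂ] FreeProduct H' ξ')}
    (hx : x ∈ pairAlgebra π hξ π' hξ') : ‖x.2‖ ≤ ‖x.1‖ := by
  cases isEmpty_or_nonempty ι with
  -- With no index there is no `A i` to compress to, but `P` consists of scalars; a unit vacuum
  -- vector gives `‖c‖ ≤ ‖c • 1‖`.
  | inl _ =>
    have hx' : x ∈ (pairAlgebra π hξ π' hξ').toSubalgebra := hx
    rw [pairAlgebra_toSubalgebra, Set.iUnion_of_empty, Algebra.adjoin_empty] at hx'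
    obtain ⟨c, rfl⟩ := Algebra.mem_bot.1 hx'
    obtain ⟨z, hz⟩ := exists_norm_eq_one_emptyWord H ξ
    have h1 := (c • (1 : FreeProduct H ξ →L[ℂ] FreeProduct H ξ)).le_opNorm
      (single (Summand H ξ) (emptyWord ι) z)
    rw [smul_apply, one_apply_eq_self, norm_smul, LinearIsometry.norm_map, hz, mul_one,
      mul_one] at h1
    rw [Algebra.algebraMap_eq_smul_one]
    refine le_trans ?_ h1
    refine (norm_smul_le c (1 : FreeProduct H' ξ' →L[ℂ] FreeProduct H' ξ')).trans ?_
    exact mul_le_of_le_one_right (norm_nonneg c) ContinuousLinearMap.norm_id_le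
  | inr _ => exact norm_snd_le_norm_fst (closure_dominatedVectors_eq_top π hξ π' hξ' hπ hφ) hx

theorem swap_mem_pairAlgebra
    {x : (FreeProduct H ξ →L[ℂ] FreeProduct H ξ) × (FreeProduct H' ξ' →L[ℂ] FreeProduct H' ξ')}
    (hx : x ∈ pairAlgebra π hξ π' hξ') : (x.2, x.1) ∈ pairAlgebra π' hξ' π hξ := by
  let s := (StarAlgHom.snd ℂ (FreeProduct H ξ →L[ℂ] FreeProduct H ξ)
    (FreeProduct H' ξ' →L[ℂ] FreeProduct H' ξ')).prod (StarAlgHom.fst ℂ _ _)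
  have h : pairAlgebra π hξ π' hξ' ≤ (pairAlgebra π' hξ' π hξ).comap s := by
    refine StarAlgebra.adjoin_le fun y hy => ?_
    obtain ⟨i, a, rfl⟩ := Set.mem_iUnion.1 hy
    exact leftAction_mem_pairAlgebra π' hξ' π hξ i a
  exact h hx

theorem norm_fst_eq_norm_snd_of_mem_pairAlgebra (hπ : ∀ i, Function.Injective (π i))
    (hπ' : ∀ i, Function.Injective (π' i)) (hφ : vectorState π ξ = vectorState π' ξ')
    {x : (FreeProduct H ξ →L[ℂ] FreeProduct H ξ) × (FreeProduct H' ξ' →L[ℂ] FreeProduct H' ξ')}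
    (hx : x ∈ pairAlgebra π hξ π' hξ') : ‖x.1‖ = ‖x.2‖ := by
  have h := swap_mem_pairAlgebra π hξ π' hξ' hx
  have h1 := norm_snd_le_norm_fst_of_mem_pairAlgebra π' hξ' π hξ hπ' hφ.symm h
  have h2 := norm_snd_le_norm_fst_of_mem_pairAlgebra π hξ π' hξ' hπ hφ hx
  exact le_antisymm h1 h2

theorem exists_starAlgEquiv_reducedFreeProduct (hπ : ∀ i, Function.Injective (π i))
    (hπ' : ∀ i, Function.Injective (π' i)) (hφ : vectorState π ξ = vectorState π' ξ') :
    ∃ Φ : ReducedFreeProduct π' hξ' ≃⋆ₐ[ℂ] ReducedFreeProduct π hξ,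
      ∀ i, ∀ a : A i, Φ (inclusion π' hξ' i a) = inclusion π hξ i a := by
  obtain ⟨Φ, hΦ⟩ := exists_starAlgEquiv_of_norm_fst_eq_norm_snd
    (fun i (a : A i) => leftAction π hξ i a) (fun i (a : A i) => leftAction π' hξ' i a)
    fun x hx => norm_fst_eq_norm_snd_of_mem_pairAlgebra π hξ π' hξ' hπ hπ' hφ hx
  exact ⟨Φ, fun i a => hΦ i a _ _ rfl rfl⟩

end Comparison

end FreeProd

end

/-- If the faithful unital representations `π i` and `π' i` of the unital C⋆-algebras `A i` and the
unit vectors `ξ i` and `ξ' i` define the same vector states, then the reduced free products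
`∗ᵢ (A i, π' i, ξ' i)` and `∗ᵢ (A i, π i, ξ i)` are `*`-isomorphic by a map which is the identity
on every `A i`. -/
theorem mainTheorem9 {n : ℕ} {A : Fin n → Type*} [∀ i, CStarAlgebra (A i)]
    {H : Fin n → Type*} [∀ i, NormedAddCommGroup (H i)] [∀ i, InnerProductSpace ℂ (H i)]
    [∀ i, CompleteSpace (H i)]
    {H' : Fin n → Type*} [∀ i, NormedAddCommGroup (H' i)] [∀ i, InnerProductSpace ℂ (H' i)]
    [∀ i, CompleteSpace (H' i)]
    (π : ∀ i, A i →⋆ₐ[ℂ] (H i →L[ℂ] H i)) (hπ : ∀ i, Function.Injective (π i))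
    (π' : ∀ i, A i →⋆ₐ[ℂ] (H' i →L[ℂ] H' i)) (hπ' : ∀ i, Function.Injective (π' i))
    {ξ : ∀ i, H i} (hξ : ∀ i, ‖ξ i‖ = 1) {ξ' : ∀ i, H' i} (hξ' : ∀ i, ‖ξ' i‖ = 1)
    (hstate : ∀ i, ∀ a : A i,
      inner ℂ (π i a (ξ i)) (ξ i) = inner ℂ (π' i a (ξ' i)) (ξ' i)) :
    ∃ Φ : FreeProd.ReducedFreeProduct π' hξ' ≃⋆ₐ[ℂ] FreeProd.ReducedFreeProduct π hξ,
      ∀ i, ∀ a : A i, Φ (FreeProd.inclusion π' hξ' i a) = FreeProd.inclusion π hξ i a := by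
  refine FreeProd.exists_starAlgEquiv_reducedFreeProduct π hξ π' hξ' hπ hπ' ?_
  funext i
  ext a
  -- The vector states are written with the operator in the linear second slot, hence the
  -- conjugation.
  rw [FreeProd.vectorState_apply, FreeProd.vectorState_apply, ← inner_conj_symm, hstate i a,
    inner_conj_symm]
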